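/- Let $T>0$, $D=(0,1)$, $\mu\ge 0$ and $r\in\{2,3\}$. Write $(\cdot,\cdot)$ and $\|\cdot\|$ for the inner product and norm of $L^2(D)$, $H^s(D)$ ($s\in\mathbb N_0$) for the Sobolev spaces of functions with generalized derivatives up to order $s$ in $L^2(D)$, with norm $\|v\|_{s,D}=(\sum_{\ell=0}^{s}\|\partial^\ell v\|^2)^{1/2}$, and $H^1_0(D)$ for the functions in $H^1(D)$ with zero trace at $0$ and $1$. Put $\lambda_k=k\pi$ and $\varepsilon_k(x)=\sqrt2\sin(\lambda_k x)$ for $k\ge1$. For $s\in\mathbb R$ put $\|v\|_{\dot{\mathbf H}^s}=\big(\sum_{k\ge1}\lambda_k^{2s}(v,\varepsilon_k)^2\big)^{1/2}$, and for $s\ge0$ let $\dot{\mathbf H}^s(D)$ be the set of $v\in L^2(D)$ for which this is finite. Finite element space: let $0=x_0<\dots<x_N=1$ be a partition with maximum mesh-length $h=\max_j(x_j-x_{j-1})$, and let $S$ be the space of all functions in $H^2(D)\cap H^1_0(D)$ that coincide on each $(x_{j-1},x_j)$ with a polynomial of degree at most $r$. Let $M_h^r$ be either $S$ itself, or a linear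 subspace of $S$ with the approximation property $$\inf_{\chi\in M_h^r}\|v-\chi\|_{2,D}\le K\,h^{s-1}\|v\|_{s+1,D}\qquad\forall\,v\in H^{s+1}(D)\cap H^1_0(D),\ s\in\{2,r\},$$ for a given constant $K$. Let $P_h$ be the $L^2(D)$-projection onto $M_h^r$, and let $\Lambda_{B,h}:M_h^r\to M_h^r$ be defined by $(\Lambda_{B,h}\varphi,\chi)=(\partial^2\varphi,\partial^2\chi)+\mu\,(\partial^2\varphi,\chi)$ for all $\varphi,\chi\in M_h^r$. Let $M\ge1$ be an integer and $\Delta\tau=T/M$, and assume $\mu^2\,\Delta\tau<\tfrac14$. For $w_0\in\dot{\mathbf H}^2(D)$ consider the following approximations of the solution of $\partial_t w+\partial_x^4w+\mu\,\partial_x^2w=0$ in $(0,T]\times D$, $w=\partial_x^2w=0$ on $\partial D$, $w(0,\cdot)=w_0$: * (Backward Euler time-discrete) $W^0=w_0$, and $W^m\in\dot{\mathbf H}^4(D)$ with $W^m-W^{m-1}+\Delta\tau\,(\partial^4W^m+\mu\,\partial^2W^m)=0$ for $m=1,\dots,M$; * (fully-discrete) $W_h^0=P_hw_0$, and $W_h^m\in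 M_h^r$ with $W_h^m-W_h^{m-1}+\Delta\tau\,\Lambda_{B,h}W_h^m=0$ for $m=1,\dots,M$. **Theorem.** There is a constant $c\ge0$, depending only on $r$, $\mu$, $T$ and $K$ (thus independent of the partition, $h$, $M_h^r$, $\Delta\tau$, $w_0$ and $\theta$), such that $$\Big(\sum_{m=1}^{M}\Delta\tau\,\|W^m-W_h^m\|^2\Big)^{1/2}\le c\,h^{\ell_\star(r)\,\theta}\,\|w_0\|_{\dot{\mathbf H}^{(r+1)\theta-2}}\qquad\forall\,\theta\in[0,1],$$ where $\ell_\star(2)=2$ and $\ell_\star(3)=4$. -/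

import Mathlib

open MeasureTheory Set Polynomial
open scoped ContDiff

namespace CHFE

/-- The space `L²(D)`, `D = (0,1)`, with Lebesgue measure; its norm and its inner product
`inner ℝ u v` are the usual ones. -/
abbrev L2D : Type := Lp ℝ 2 (volume.restrict (Ioo (0 : ℝ) 1))

/-- Test functions on `D`: smooth, with compact support inside `(0,1)`. -/
def IsTest (φ : ℝ → ℝ) : Prop :=
  ContDiff ℝ ∞ φ ∧ HasCompactSupport φ ∧ tsupport φ ⊆ Ioo (0 : ℝ) 1

/-- `g ∈ L²(D)` is the generalized derivative of order `n` of `u ∈ L²(D)` on `D`. -/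
def HasWeakDeriv (n : ℕ) (u g : L2D) : Prop :=
  ∀ φ : ℝ → ℝ, IsTest φ →
    ∫ y in Ioo (0 : ℝ) 1, u y * iteratedDeriv n φ y =
      (-1) ^ n * ∫ y in Ioo (0 : ℝ) 1, g y * φ y

/-- The Sobolev space `H^s(D)`, `s ∈ ℕ`. -/
def MemH (s : ℕ) (u : L2D) : Prop := ∀ n ≤ s, ∃ g : L2D, HasWeakDeriv n u g

open Classical in
/-- The generalized derivative `∂ⁿu` (unique, see `HasWeakDeriv.unique`); only used where it
exists. -/
noncomputable def weakDeriv (n : ℕ) (u : L2D) : L2D :=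
  if h : ∃ g : L2D, HasWeakDeriv n u g then h.choose else 0

/-- The usual norm of `H^s(D)`. -/
noncomputable def sobolevNorm (s : ℕ) (u : L2D) : ℝ :=
  Real.sqrt (∑ n ∈ Finset.range (s + 1), ‖weakDeriv n u‖ ^ 2)

/-- Vanishing trace at both endpoints: the continuous representative on `[0,1]` is zero at `0`
and at `1`. -/
def VanishesAtEndpoints (u : L2D) : Prop :=
  ∃ v : ℝ → ℝ, ContinuousOn v (Icc 0 1) ∧ v 0 = 0 ∧ v 1 = 0 ∧
    ∀ᵐ y ∂(volume.restrict (Ioo (0 : ℝ) 1)), u y = v y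

/-- The space `H¹₀(D)`. -/
def MemH01 (u : L2D) : Prop := MemH 1 u ∧ VanishesAtEndpoints u

/-- `λ_{k+1} = (k+1)π`; indices are shifted, so that `k` runs over all natural numbers. -/
noncomputable def lam (k : ℕ) : ℝ := ((k : ℝ) + 1) * Real.pi

/-- The Fourier coefficient `(v, ε_{k+1})`, where `ε_{k+1}(y) = √2 sin(λ_{k+1} y)`. -/
noncomputable def sineCoeff (k : ℕ) (v : L2D) : ℝ :=
  ∫ y in Ioo (0 : ℝ) 1, v y * (Real.sqrt 2 * Real.sin (lam k * y))

/-- Membership of `v ∈ L²(D)` in the space of functions with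
`∑ λ_k^{2s} (v, ε_k)² < ∞`; for `s ≥ 0` this space is `Ḣ^s(D)`. -/
def MemHdot (s : ℝ) (v : L2D) : Prop :=
  Summable fun k : ℕ => lam k ^ (2 * s) * sineCoeff k v ^ 2

/-- The `Ḣ^s` norm, `s ∈ ℝ`. -/
noncomputable def hdotNorm (s : ℝ) (v : L2D) : ℝ :=
  Real.sqrt (∑' k : ℕ, lam k ^ (2 * s) * sineCoeff k v ^ 2)

/-- The operator `Λ_B v = ∂⁴v + μ ∂²v`, applied to `v ∈ Ḣ⁴(D)` only. -/
noncomputable def ellipticOp (μ : ℝ) (v : L2D) : L2D := weakDeriv 4 v + μ • weakDeriv 2 v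

/-- `W⁰, …, W^M` are the Backward Euler time-discrete approximations with step `τ`:
`W⁰ = w₀`, and `W^m ∈ Ḣ⁴(D)`, `W^m - W^{m-1} + τ Λ_B W^m = 0` for `m = 1, …, M`. -/
def IsTimeDiscrete (μ τ : ℝ) (M : ℕ) (w₀ : L2D) (W : ℕ → L2D) : Prop :=
  W 0 = w₀ ∧ ∀ m ∈ Finset.Icc 1 M,
    MemHdot 4 (W m) ∧ W m - W (m - 1) + τ • ellipticOp μ (W m) = 0

/-- `x₀ < x₁ < … < x_N` is a partition of `(0,1)` with maximum mesh-length `h`. -/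
def IsPartition (N : ℕ) (x : Fin (N + 1) → ℝ) (h : ℝ) : Prop :=
  x 0 = 0 ∧ x (Fin.last N) = 1 ∧ StrictMono x ∧
    IsGreatest (range fun j : Fin N => x j.succ - x j.castSucc) h

/-- `u` agrees on each subinterval of the partition with a polynomial of degree at most `r`. -/
def IsPiecewisePoly (r : ℕ) {N : ℕ} (x : Fin (N + 1) → ℝ) (u : L2D) : Prop :=
  ∀ j : Fin N, ∃ p : ℝ[X], p.natDegree ≤ r ∧
    ∀ᵐ y ∂(volume.restrict (Ioo (0 : ℝ) 1)),
      y ∈ Ioo (x j.castSucc) (x j.succ) → u y = p.eval y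

/-! ### Elementary facts on generalized derivatives -/

lemma IsTest.iteratedDeriv_props {φ : ℝ → ℝ} (hφ : IsTest φ) (n : ℕ) :
    Continuous (iteratedDeriv n φ) ∧ HasCompactSupport (iteratedDeriv n φ) := by
  refine ⟨hφ.1.continuous_iteratedDeriv n (by exact_mod_cast le_top), ?_⟩
  have : iteratedDeriv n φ = deriv^[n] φ := iteratedDeriv_eq_iterate
  rw [this]
  clear this
  induction n with
  | zero => exact hφ.2.1
  | succ n ih => rw [Function.iterate_succ_apply']; exact ih.deriv

lemma integrable_mul_test (u : L2D) {ψ : ℝ → ℝ} (hc : Continuous ψ) (hs : HasCompactSupport ψ) :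
    Integrable (fun y => u y * ψ y) (volume.restrict (Ioo (0 : ℝ) 1)) :=
  MemLp.integrable_mul (p := 2) (q := 2) (Lp.memLp u)
    ((hc.memLp_of_hasCompactSupport hs).restrict _)

lemma integral_add_mul (u v : L2D) {ψ : ℝ → ℝ} (hc : Continuous ψ) (hs : HasCompactSupport ψ) :
    ∫ y in Ioo (0 : ℝ) 1, (u + v : L2D) y * ψ y =
      (∫ y in Ioo (0 : ℝ) 1, u y * ψ y) + ∫ y in Ioo (0 : ℝ) 1, v y * ψ y := by
  rw [← integral_add (integrable_mul_test u hc hs) (integrable_mul_test v hc hs)]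
  refine integral_congr_ae ?_
  filter_upwards [Lp.coeFn_add u v] with y hy
  rw [hy, Pi.add_apply, add_mul]

lemma integral_smul_mul (a : ℝ) (u : L2D) (ψ : ℝ → ℝ) :
    ∫ y in Ioo (0 : ℝ) 1, (a • u : L2D) y * ψ y = a * ∫ y in Ioo (0 : ℝ) 1, u y * ψ y := by
  rw [← integral_const_mul]
  refine integral_congr_ae ?_
  filter_upwards [Lp.coeFn_smul a u] with y hy
  rw [hy, Pi.smul_apply, smul_eq_mul, mul_assoc]

lemma HasWeakDeriv.add {n : ℕ} {u v g k : L2D} (hu : HasWeakDeriv n u g)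
    (hv : HasWeakDeriv n v k) : HasWeakDeriv n (u + v) (g + k) := by
  intro φ hφ
  obtain ⟨h1, h2⟩ := hφ.iteratedDeriv_props n
  rw [integral_add_mul u v h1 h2, integral_add_mul g k hφ.1.continuous hφ.2.1, hu φ hφ, hv φ hφ]
  ring

lemma HasWeakDeriv.smul {n : ℕ} {u g : L2D} (a : ℝ) (hu : HasWeakDeriv n u g) :
    HasWeakDeriv n (a • u) (a • g) := by
  intro φ hφ
  rw [integral_smul_mul, integral_smul_mul, hu φ hφ]
  ring

/-- Generalized derivatives are unique. -/
lemma HasWeakDeriv.unique {n : ℕ} {u g k : L2D} (hg : HasWeakDeriv n u g)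
    (hk : HasWeakDeriv n u k) : g = k := by
  have hd : HasWeakDeriv n (u + (-1 : ℝ) • u) (g + (-1 : ℝ) • k) := hg.add (hk.smul (-1))
  have hz : u + (-1 : ℝ) • u = 0 := by simp
  have key : ∀ᵐ y ∂(volume : Measure ℝ), y ∈ Ioo (0 : ℝ) 1 → (g + (-1 : ℝ) • k : L2D) y = 0 := by
    refine isOpen_Ioo.ae_eq_zero_of_integral_contDiff_smul_eq_zero
      (f := fun y => (g + (-1 : ℝ) • k : L2D) y) ?_ ?_
    · have : IntegrableOn (fun y => (g + (-1 : ℝ) • k : L2D) y) (Ioo (0 : ℝ) 1) :=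
        (Lp.memLp (g + (-1 : ℝ) • k)).integrable one_le_two
      exact this.locallyIntegrableOn
    · intro φ h1 h2 h3
      have h := hd φ ⟨h1, h2, h3⟩
      rw [hz] at h
      have h0 : ∫ y in Ioo (0 : ℝ) 1, (0 : L2D) y * iteratedDeriv n φ y = 0 := by
        have := integral_smul_mul 0 (0 : L2D) (iteratedDeriv n φ)
        simpa using this
      rw [h0] at h
      have h' : ∫ y in Ioo (0 : ℝ) 1, (g + (-1 : ℝ) • k : L2D) y * φ y = 0 := by
        rcases mul_eq_zero.mp h.symm with h | h
        · exact absurd h (pow_ne_zero _ (by norm_num))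
        · exact h
      refine Eq.trans ?_ h'
      rw [← integral_indicator measurableSet_Ioo]
      refine integral_congr_ae (Filter.Eventually.of_forall fun y => ?_)
      by_cases hy : y ∈ Ioo (0 : ℝ) 1
      · simp only [indicator_of_mem hy, smul_eq_mul, mul_comm]
      · have : φ y = 0 := image_eq_zero_of_notMem_tsupport fun h => hy (h3 h)
        simp [indicator_of_notMem hy, this]
  have hzero : g + (-1 : ℝ) • k = 0 := by
    refine Lp.ext ?_
    have := (ae_restrict_iff' (μ := (volume : Measure ℝ)) measurableSet_Ioo).mpr key
    filter_upwards [this, Lp.coeFn_zero ℝ 2 (volume.restrict (Ioo (0 : ℝ) 1))] with y h1 h2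
    rw [h1, h2]; rfl
  simpa [← sub_eq_add_neg, sub_eq_zero] using hzero

lemma MemH.add {s : ℕ} {u v : L2D} (hu : MemH s u) (hv : MemH s v) : MemH s (u + v) := by
  intro n hn
  obtain ⟨g, hg⟩ := hu n hn
  obtain ⟨k, hk⟩ := hv n hn
  exact ⟨_, hg.add hk⟩

lemma MemH.smul {s : ℕ} {u : L2D} (a : ℝ) (hu : MemH s u) : MemH s (a • u) := by
  intro n hn
  obtain ⟨g, hg⟩ := hu n hn
  exact ⟨_, hg.smul a⟩

lemma hasWeakDeriv_zero (n : ℕ) : HasWeakDeriv n 0 0 := by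
  have h : ∀ ψ : ℝ → ℝ, ∫ y in Ioo (0 : ℝ) 1, (0 : L2D) y * ψ y = 0 := fun ψ => by
    simpa using integral_smul_mul 0 (0 : L2D) ψ
  intro φ _
  rw [h, h, mul_zero]

lemma MemH01.add {u v : L2D} (hu : MemH01 u) (hv : MemH01 v) : MemH01 (u + v) := by
  obtain ⟨hu1, f, hf, hf0, hf1, hfe⟩ := hu
  obtain ⟨hv1, g, hg, hg0, hg1, hge⟩ := hv
  refine ⟨hu1.add hv1, f + g, hf.add hg, by simp [hf0, hg0], by simp [hf1, hg1], ?_⟩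
  filter_upwards [Lp.coeFn_add u v, hfe, hge] with y h1 h2 h3
  rw [h1, Pi.add_apply, Pi.add_apply, h2, h3]

lemma MemH01.smul {u : L2D} (a : ℝ) (hu : MemH01 u) : MemH01 (a • u) := by
  obtain ⟨hu1, f, hf, hf0, hf1, hfe⟩ := hu
  refine ⟨hu1.smul a, a • f, hf.const_smul a, by simp [hf0], by simp [hf1], ?_⟩
  filter_upwards [Lp.coeFn_smul a u, hfe] with y h1 h2
  rw [h1, Pi.smul_apply, Pi.smul_apply, h2]

lemma memH01_zero : MemH01 0 := by
  refine ⟨fun n _ => ⟨0, hasWeakDeriv_zero n⟩, 0, continuousOn_const, rfl, rfl, ?_⟩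
  filter_upwards [Lp.coeFn_zero ℝ 2 (volume.restrict (Ioo (0 : ℝ) 1))] with y h1
  rw [h1]

lemma IsPiecewisePoly.add {r N : ℕ} {x : Fin (N + 1) → ℝ} {u v : L2D}
    (hu : IsPiecewisePoly r x u) (hv : IsPiecewisePoly r x v) :
    IsPiecewisePoly r x (u + v) := by
  intro j
  obtain ⟨p, hp, hpe⟩ := hu j
  obtain ⟨q, hq, hqe⟩ := hv j
  refine ⟨p + q, natDegree_add_le_of_degree_le hp hq, ?_⟩
  filter_upwards [Lp.coeFn_add u v, hpe, hqe] with y h1 h2 h3 hy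
  rw [h1, Pi.add_apply, h2 hy, h3 hy, eval_add]

lemma IsPiecewisePoly.smul {r N : ℕ} {x : Fin (N + 1) → ℝ} {u : L2D} (a : ℝ)
    (hu : IsPiecewisePoly r x u) : IsPiecewisePoly r x (a • u) := by
  intro j
  obtain ⟨p, hp, hpe⟩ := hu j
  refine ⟨a • p, (natDegree_smul_le a p).trans hp, ?_⟩
  filter_upwards [Lp.coeFn_smul a u, hpe] with y h1 h2 hy
  rw [h1, Pi.smul_apply, h2 hy, eval_smul]

lemma isPiecewisePoly_zero {r N : ℕ} (x : Fin (N + 1) → ℝ) : IsPiecewisePoly r x 0 := by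
  intro j
  refine ⟨0, by simp, ?_⟩
  filter_upwards [Lp.coeFn_zero ℝ 2 (volume.restrict (Ioo (0 : ℝ) 1))] with y h1 _
  rw [h1, Pi.zero_apply, eval_zero]

/-! ### Finite element spaces and the fully-discrete method -/

/-- All functions in `H²(D) ∩ H¹₀(D)` that are piecewise polynomials of degree at most `r` over
the partition `x`. -/
def splineSpace (r : ℕ) {N : ℕ} (x : Fin (N + 1) → ℝ) : Submodule ℝ L2D where
  carrier := {u | MemH 2 u ∧ MemH01 u ∧ IsPiecewisePoly r x u}
  add_mem' := fun hu hv => ⟨hu.1.add hv.1, hu.2.1.add hv.2.1, hu.2.2.add hv.2.2⟩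
  zero_mem' := ⟨fun n _ => ⟨0, hasWeakDeriv_zero n⟩, memH01_zero, isPiecewisePoly_zero x⟩
  smul_mem' := fun a _ hu => ⟨hu.1.smul a, hu.2.1.smul a, hu.2.2.smul a⟩

/-- The approximation property with constant `K`:
`inf_{χ ∈ V} ‖v - χ‖_{2,D} ≤ K h^{s-1} ‖v‖_{s+1,D}` for `v ∈ H^{s+1}(D) ∩ H¹₀(D)`, `s ∈ {2, r}`. -/
def HasApproxProperty (K : ℝ) (r : ℕ) (h : ℝ) (V : Submodule ℝ L2D) : Prop :=
  ∀ s : ℕ, s = 2 ∨ s = r → ∀ v : L2D, MemH (s + 1) v → MemH01 v →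
    ⨅ χ : V, sobolevNorm 2 (v - (χ : L2D)) ≤ K * h ^ (s - 1) * sobolevNorm (s + 1) v

/-- Finite element spaces `M_h^r` over the partition `x`: the space of all piecewise polynomials
of degree at most `r` in `H²(D) ∩ H¹₀(D)`, or a linear subspace of it that has the approximation
property with constant `K`. -/
def IsFiniteElementSpace (K : ℝ) (r : ℕ) {N : ℕ} (x : Fin (N + 1) → ℝ) (h : ℝ)
    (V : Submodule ℝ L2D) : Prop :=
  V = splineSpace r x ∨ (V ≤ splineSpace r x ∧ HasApproxProperty K r h V)

/-- `p = P_h f`, the `L²(D)`-projection of `f` onto `V`. -/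
def IsL2Projection (V : Submodule ℝ L2D) (f p : L2D) : Prop :=
  p ∈ V ∧ ∀ χ ∈ V, inner ℝ p χ = inner ℝ f χ

/-- `z = Λ_{B,h} φ`: the element `z` of `V` with
`(z, χ) = (∂²φ, ∂²χ) + μ (∂²φ, χ)` for all `χ ∈ V`. -/
def IsDiscreteElliptic (μ : ℝ) (V : Submodule ℝ L2D) (φ z : L2D) : Prop :=
  z ∈ V ∧ ∀ χ ∈ V, inner ℝ z χ =
    inner ℝ (weakDeriv 2 φ) (weakDeriv 2 χ) + μ * inner ℝ (weakDeriv 2 φ) χ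

/-- `W_h⁰, …, W_h^M ∈ V` are the Backward Euler finite element approximations with step `τ`:
`W_h⁰ = P_h w₀` and `W_h^m - W_h^{m-1} + τ Λ_{B,h} W_h^m = 0` for `m = 1, …, M`. -/
def IsFullyDiscrete (μ τ : ℝ) (M : ℕ) (V : Submodule ℝ L2D) (w₀ : L2D) (Wh : ℕ → L2D) : Prop :=
  IsL2Projection V w₀ (Wh 0) ∧ ∀ m ∈ Finset.Icc 1 M,
    Wh m ∈ V ∧ ∃ z : L2D, IsDiscreteElliptic μ V (Wh m) z ∧ Wh m - Wh (m - 1) + τ • z = 0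

/-- The exponent `ℓ_⋆(2) = 2`, `ℓ_⋆(3) = 4`. -/
def ellStar (r : ℕ) : ℝ := if r = 2 then 2 else 4

/-- The exponent `ξ_⋆(r, θ) = (r + 1) θ - 2`. -/
def xiStar (r : ℕ) (θ : ℝ) : ℝ := ((r : ℝ) + 1) * θ - 2

end CHFE

namespace CHFE

/-! ### The sine basis of `L²(0,1)` -/

/-! For small θ the norm of the data is a negative one, so the error is measured through the energy
(e, T e). Here T is the Galerkin solution operator on V of the shifted problem ∂⁴z + μ ∂²z + μ² z =
f. The shift μ² makes the bilinear form coercive for every μ ≥ 0 (`shiftedForm_coercive`). Its price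
is a term μ² (e, T e), which a discrete Gronwall inequality absorbs; this is where μ² Δτ < 1/4
enters. Testing the error equation with T e gives (`IsDiscreteSolution.energy_estimate`) Σ Δτ ‖e^m‖²
≤ C ((e⁰, T e⁰) + Σ Δτ ‖ρ^m‖²).

Two endpoint bounds follow. With no right-hand side, (w₀, T w₀) is at most twice the squared Ḣ⁻²
norm of w₀, so each method separately is stable in that norm: this is θ = 0
(`errorSq_le_stability`). For the difference of the two methods the initial term vanishes, because T
sees w₀ only through its projection, and ρ is the error of the elliptic projection. Duality
(`IsDiscreteSolution.elliptic_error`) bounds ‖ρ‖ by the square of the approximation order h^(r-1) of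
second derivatives, that is by h^(2(r-1)) = h^ℓ⋆, times the Ḣ^(r+1) norm of W^m. The smoothing of
backward Euler, checked mode by mode, trades that norm, summed in time, for the Ḣ^(r-1) norm of w₀:
this is θ = 1 (`errorSq_le_rate`).

For intermediate θ no abstract interpolation is needed. The modes of w₀ are split at λ_k^(r+1) =
h^(-ℓ⋆), the rate is applied to the low modes and the stability to the high ones
(`errorSq_le_interpolation`).

The analytic base is the sine basis of L²(0,1) and the identification of H² ∩ H¹₀ with a condition
on sine coefficients (`IsLaplace`). Splines of arbitrary partitions are handled by prescribing the
second derivative: solving u'' = g with g piecewise constant or piecewise linear gives a spline with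
no further matching conditions. -/

lemma inner_eq_integral (u v : L2D) :
    inner ℝ u v = ∫ y in Ioo (0 : ℝ) 1, u y * v y := by
  rw [L2.inner_def]
  refine integral_congr_ae (Filter.Eventually.of_forall fun y => ?_)
  simp [mul_comm]

lemma norm_sq_eq_integral (u : L2D) : ‖u‖ ^ 2 = ∫ y in Ioo (0 : ℝ) 1, u y ^ 2 := by
  rw [← real_inner_self_eq_norm_sq, inner_eq_integral]
  simp only [sq]

lemma memLp_of_continuous {f : ℝ → ℝ} (hf : Continuous f) :
    MemLp f 2 (volume.restrict (Ioo (0 : ℝ) 1)) := by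
  obtain ⟨C, hC⟩ := isCompact_Icc.exists_bound_of_continuousOn (s := Icc (0 : ℝ) 1) hf.continuousOn
  refine MemLp.of_bound hf.aestronglyMeasurable C ?_
  filter_upwards [ae_restrict_mem measurableSet_Ioo] with y hy
  exact hC y (Ioo_subset_Icc_self hy)

/-- The element of `L²(0,1)` given by a continuous function. -/
noncomputable def ofCont (f : ℝ → ℝ) (hf : Continuous f) : L2D := (memLp_of_continuous hf).toLp f

lemma coeFn_ofCont {f : ℝ → ℝ} (hf : Continuous f) :
    ofCont f hf =ᵐ[volume.restrict (Ioo (0 : ℝ) 1)] f := MemLp.coeFn_toLp _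

lemma integral_ofCont_mul {f : ℝ → ℝ} (hf : Continuous f) (g : ℝ → ℝ) :
    ∫ y in Ioo (0 : ℝ) 1, ofCont f hf y * g y = ∫ y in Ioo (0 : ℝ) 1, f y * g y := by
  refine integral_congr_ae ?_
  filter_upwards [coeFn_ofCont hf] with y hy
  rw [hy]

lemma inner_ofCont {f : ℝ → ℝ} (hf : Continuous f) (v : L2D) :
    inner ℝ (ofCont f hf) v = ∫ y in Ioo (0 : ℝ) 1, v y * f y := by
  rw [inner_eq_integral, integral_ofCont_mul]
  simp only [mul_comm]

lemma setIntegral_Ioo_eq (f : ℝ → ℝ) :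
    ∫ y in Ioo (0 : ℝ) 1, f y = ∫ y in (0 : ℝ)..1, f y := by
  rw [intervalIntegral.integral_of_le zero_le_one, integral_Ioc_eq_integral_Ioo]

lemma lam_pos (k : ℕ) : 0 < lam k := by unfold lam; positivity

lemma one_le_lam (k : ℕ) : 1 ≤ lam k := by
  unfold lam
  have := Real.pi_gt_three
  nlinarith [(Nat.cast_nonneg k : (0 : ℝ) ≤ k)]

lemma sin_lam (k : ℕ) : Real.sin (lam k) = 0 := by
  unfold lam
  exact_mod_cast Real.sin_nat_mul_pi (k + 1)

lemma continuous_sine (k : ℕ) : Continuous fun y => Real.sqrt 2 * Real.sin (lam k * y) := by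
  fun_prop

/-- `ε_{k+1}` as an element of `L²(0,1)`. -/
noncomputable def sineFn (k : ℕ) : L2D := ofCont _ (continuous_sine k)

lemma sineCoeff_eq_inner (k : ℕ) (v : L2D) : sineCoeff k v = inner ℝ (sineFn k) v := by
  rw [sineFn, inner_ofCont, sineCoeff]

lemma integral_cos_int_mul_pi (n : ℤ) (hn : n ≠ 0) :
    ∫ y in (0 : ℝ)..1, Real.cos (n * Real.pi * y) = 0 := by
  have hc : (n * Real.pi : ℝ) ≠ 0 := mul_ne_zero (by exact_mod_cast hn) Real.pi_ne_zero
  rw [intervalIntegral.integral_comp_mul_left (fun y => Real.cos y) hc]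
  simp [Real.sin_int_mul_pi]

lemma integral_sine_mul_sine (j k : ℕ) :
    ∫ y in (0 : ℝ)..1, (Real.sqrt 2 * Real.sin (lam j * y)) * (Real.sqrt 2 * Real.sin (lam k * y)) =
      if j = k then 1 else 0 := by
  have key : ∀ y : ℝ, (Real.sqrt 2 * Real.sin (lam j * y)) * (Real.sqrt 2 * Real.sin (lam k * y)) =
      Real.cos (((j : ℤ) - (k : ℤ) : ℤ) * Real.pi * y) -
        Real.cos (((j : ℤ) + (k : ℤ) + 2 : ℤ) * Real.pi * y) := by
    intro y
    have e1 : (((j : ℤ) - (k : ℤ) : ℤ) : ℝ) * Real.pi * y = lam j * y - lam k * y := by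
      simp only [lam]; push_cast; ring
    have e2 : (((j : ℤ) + (k : ℤ) + 2 : ℤ) : ℝ) * Real.pi * y = lam j * y + lam k * y := by
      simp only [lam]; push_cast; ring
    have h2 : Real.sqrt 2 * Real.sqrt 2 = 2 := Real.mul_self_sqrt (by norm_num)
    rw [e1, e2, Real.cos_sub, Real.cos_add]
    linear_combination Real.sin (lam j * y) * Real.sin (lam k * y) * h2
  simp only [key]
  rw [intervalIntegral.integral_sub (Continuous.intervalIntegrable (by fun_prop) _ _)
    (Continuous.intervalIntegrable (by fun_prop) _ _),
    integral_cos_int_mul_pi ((j : ℤ) + (k : ℤ) + 2) (by omega)]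
  split_ifs with hjk
  · subst hjk; simp
  · rw [integral_cos_int_mul_pi _ (by omega), sub_zero]

lemma orthonormal_sineFn : Orthonormal ℝ sineFn := by
  classical
  rw [orthonormal_iff_ite]
  intro j k
  rw [sineFn, inner_ofCont, sineFn, integral_ofCont_mul, setIntegral_Ioo_eq,
    integral_sine_mul_sine]
  exact if_congr eq_comm rfl rfl

/-! ### Completeness of the sine system -/

/-- Extension of a function on `(0,1)` by zero. -/
noncomputable def extZero (g : L2D) : ℝ → ℝ := (Ioo (0 : ℝ) 1).indicator g

lemma memLp_extZero (g : L2D) : MemLp (extZero g) 2 volume :=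
  (memLp_indicator_iff_restrict measurableSet_Ioo).mpr (Lp.memLp g)

lemma integrable_extZero (g : L2D) : Integrable (extZero g) :=
  (integrable_indicator_iff measurableSet_Ioo).mpr ((Lp.memLp g).integrable one_le_two)

lemma intervalIntegral_extZero_mul (g : L2D) (f : ℝ → ℝ) :
    ∫ y in (0 : ℝ)..1, extZero g y * f y = ∫ y in Ioo (0 : ℝ) 1, g y * f y := by
  rw [← setIntegral_Ioo_eq]
  refine setIntegral_congr_fun measurableSet_Ioo fun y hy => ?_
  simp [extZero, indicator_of_mem hy]

lemma integral_extZero_mul_sin_eq_zero {v : L2D} (hv : ∀ k, sineCoeff k v = 0) (n : ℤ) :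
    ∫ y in (0 : ℝ)..1, extZero v y * Real.sin (n * Real.pi * y) = 0 := by
  have hnat : ∀ k : ℕ, ∫ y in (0 : ℝ)..1, extZero v y * Real.sin (((k : ℝ) + 1) * Real.pi * y) = 0 := by
    intro k
    have h := hv k
    rw [sineCoeff] at h
    have e : ∀ y, v y * (Real.sqrt 2 * Real.sin (lam k * y)) =
        Real.sqrt 2 * (v y * Real.sin (lam k * y)) := fun y => by ring
    simp only [e] at h
    rw [integral_const_mul] at h
    rw [intervalIntegral_extZero_mul]
    exact (mul_eq_zero.mp h).resolve_left (by positivity)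
  rcases lt_trichotomy n 0 with hn | hn | hn
  · obtain ⟨k, rfl⟩ : ∃ k : ℕ, n = -((k : ℤ) + 1) := ⟨(-n - 1).toNat, by omega⟩
    have := hnat k
    push_cast
    simp only [neg_mul, Real.sin_neg, mul_neg, intervalIntegral.integral_neg]
    rw [this, neg_zero]
  · subst hn; simp
  · obtain ⟨k, rfl⟩ : ∃ k : ℕ, n = (k : ℤ) + 1 := ⟨(n - 1).toNat, by omega⟩
    push_cast
    exact hnat k

/-- Completeness reduces to that of the Fourier system on (-1,1): the odd extension of v has only
sine coefficients there, these vanish by hypothesis, and Parseval then forces the extension to be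
zero. -/
lemma eq_zero_of_sineCoeff_eq_zero {v : L2D} (hv : ∀ k, sineCoeff k v = 0) : v = 0 := by
  have hmp : MeasurePreserving (fun x : ℝ => -x) volume volume := Measure.measurePreserving_neg _
  set F : ℝ → ℂ := fun x => ((extZero v x - extZero v (-x) : ℝ) : ℂ) with hF
  have hL2 : MemLp F 2 volume :=
    ((memLp_extZero v).sub ((memLp_extZero v).comp_measurePreserving hmp)).ofReal
  have hlt : (-1 : ℝ) < 1 := by norm_num
  have hcoef : ∀ n, fourierCoeffOn hlt F n = 0 := by
    intro n
    rw [fourierCoeffOn_eq_integral]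
    refine smul_eq_zero_of_right _ ?_
    have hfour : ∀ x : ℝ, fourier (-n) (x : AddCircle (1 - (-1 : ℝ))) =
        ((Real.cos (n * Real.pi * x) : ℝ) : ℂ) -
          ((Real.sin (n * Real.pi * x) : ℝ) : ℂ) * Complex.I := by
      intro x
      rw [fourier_coe_apply]
      have e : 2 * (Real.pi : ℂ) * Complex.I * ((-n : ℤ) : ℂ) * x / ((1 - (-1 : ℝ) : ℝ) : ℂ) =
          ((-(n * Real.pi * x) : ℝ) : ℂ) * Complex.I := by
        push_cast; ring
      rw [e, Complex.exp_mul_I, ← Complex.ofReal_cos, ← Complex.ofReal_sin, Real.cos_neg,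
        Real.sin_neg]
      push_cast; ring
    have hint : IntervalIntegrable (extZero v) volume (-1) 1 :=
      (integrable_extZero v).intervalIntegrable
    have hintn : IntervalIntegrable (fun x => extZero v (-x)) volume (-1) 1 :=
      (hmp.integrable_comp_of_integrable (integrable_extZero v)).intervalIntegrable
    -- The integrand is odd, so reflection shows that the integral equals its own negative.
    have hc : ∫ x in (-1 : ℝ)..1, (extZero v x - extZero v (-x)) * Real.cos (n * Real.pi * x) = 0 := by
      have h1 := intervalIntegral.integral_comp_neg (a := (-1 : ℝ)) (b := 1)
        (fun x => (extZero v x - extZero v (-x)) * Real.cos (n * Real.pi * x))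
      simp only [mul_neg, Real.cos_neg, neg_neg] at h1
      have h2 : ∀ x, (extZero v (-x) - extZero v x) * Real.cos (n * Real.pi * x) =
        -((extZero v x - extZero v (-x)) * Real.cos (n * Real.pi * x)) := fun x => by ring
      simp only [h2, intervalIntegral.integral_neg] at h1
      linarith
    -- The extension by zero contributes nothing on (-1,0), and the reflected term is minus the
    -- first one.
    have hs : ∫ x in (-1 : ℝ)..1, (extZero v x - extZero v (-x)) * Real.sin (n * Real.pi * x) = 0 := by
      have h0 : ∫ x in (-1 : ℝ)..1, extZero v x * Real.sin (n * Real.pi * x) = 0 := by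
        have hi : ∀ a b : ℝ, IntervalIntegrable
            (fun x => extZero v x * Real.sin (n * Real.pi * x)) volume a b := fun a b =>
          ((integrable_extZero v).intervalIntegrable).mul_continuousOn (by fun_prop)
        rw [← intervalIntegral.integral_add_adjacent_intervals (hi (-1) 0) (hi 0 1),
          integral_extZero_mul_sin_eq_zero hv, add_zero]
        refine intervalIntegral.integral_zero_ae (Filter.Eventually.of_forall fun x hx => ?_)
        rw [uIoc_of_le (by norm_num)] at hx
        rw [extZero, indicator_of_notMem (fun h => absurd h.1 (not_lt.mpr hx.2)), zero_mul]
      have h1 := intervalIntegral.integral_comp_neg (a := (-1 : ℝ)) (b := 1)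
        (fun x => extZero v x * Real.sin (n * Real.pi * x))
      simp only [mul_neg, Real.sin_neg, neg_neg, h0, intervalIntegral.integral_neg] at h1
      simp only [sub_mul]
      rw [intervalIntegral.integral_sub (hint.mul_continuousOn (by fun_prop))
        (hintn.mul_continuousOn (by fun_prop)), h0]
      linarith
    have hsplit : ∀ x : ℝ, fourier (-n) (x : AddCircle (1 - (-1 : ℝ))) • F x =
        (((extZero v x - extZero v (-x)) * Real.cos (n * Real.pi * x) : ℝ) : ℂ) -
          (((extZero v x - extZero v (-x)) * Real.sin (n * Real.pi * x) : ℝ) : ℂ) * Complex.I := by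
      intro x
      rw [hfour, hF, smul_eq_mul]
      push_cast; ring
    simp only [hsplit]
    rw [intervalIntegral.integral_sub, intervalIntegral.integral_mul_const,
      intervalIntegral.integral_ofReal, intervalIntegral.integral_ofReal, hc, hs]
    · simp
    · have h := (hint.sub hintn).mul_continuousOn (g := fun x => Real.cos (n * Real.pi * x))
        (by fun_prop)
      exact ⟨h.1.ofReal, h.2.ofReal⟩
    · have h := (hint.sub hintn).mul_continuousOn (g := fun x => Real.sin (n * Real.pi * x))
        (by fun_prop)
      exact IntervalIntegrable.mul_const ⟨h.1.ofReal, h.2.ofReal⟩ _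
  have hP := hasSum_sq_fourierCoeffOn hlt (hL2.restrict (Ioc (-1 : ℝ) 1))
  simp only [hcoef, norm_zero, ne_eq, OfNat.ofNat_ne_zero, not_false_eq_true, zero_pow] at hP
  have h0 := hP.unique hasSum_zero
  have h1 : ∫ x in (-1 : ℝ)..1, ‖F x‖ ^ 2 = 0 := (smul_eq_zero.mp h0).resolve_left (by norm_num)
  rw [intervalIntegral.integral_of_le hlt.le, integral_eq_zero_iff_of_nonneg
    (fun x => by positivity) ((hL2.restrict _).integrable_norm_pow (by norm_num))] at h1
  have hsub : Ioo (0 : ℝ) 1 ⊆ Ioc (-1 : ℝ) 1 := fun x hx => ⟨by linarith [hx.1], hx.2.le⟩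
  have h2 : ∀ᵐ x ∂(volume.restrict (Ioo (0 : ℝ) 1)), ‖F x‖ ^ 2 = 0 :=
    ae_restrict_of_ae_restrict_of_subset hsub h1
  refine Lp.ext ?_
  filter_upwards [h2, ae_restrict_mem measurableSet_Ioo,
    Lp.coeFn_zero ℝ 2 (volume.restrict (Ioo (0 : ℝ) 1))] with x hx hx1 h3
  rw [h3, Pi.zero_apply]
  -- On (0,1) the reflected summand of F vanishes, so F coincides with v there.
  have hx0 : -x ∉ Ioo (0 : ℝ) 1 := fun h => by linarith [h.1, hx1.1]
  have : F x = 0 := by simpa using hx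
  rw [hF] at this
  simpa [extZero, indicator_of_mem hx1, indicator_of_notMem hx0] using this

/-- The functions `ε_k` form a Hilbert basis of `L²(0,1)`. -/
noncomputable def sineBasis : HilbertBasis ℕ ℝ L2D :=
  HilbertBasis.mkOfOrthogonalEqBot orthonormal_sineFn (by
    rw [Submodule.eq_bot_iff]
    intro v hv
    refine eq_zero_of_sineCoeff_eq_zero fun k => ?_
    rw [sineCoeff_eq_inner]
    exact (Submodule.mem_orthogonal _ _).mp hv _ (Submodule.subset_span ⟨k, rfl⟩))

lemma sineBasis_apply (k : ℕ) : sineBasis k = sineFn k := by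
  rw [sineBasis, HilbertBasis.coe_mkOfOrthogonalEqBot]

lemma sineBasis_repr (v : L2D) (k : ℕ) : sineBasis.repr v k = sineCoeff k v := by
  rw [HilbertBasis.repr_apply_apply, sineBasis_apply, sineCoeff_eq_inner]

lemma hasSum_sineCoeff_mul (u v : L2D) :
    HasSum (fun k => sineCoeff k u * sineCoeff k v) (inner ℝ u v) := by
  have := sineBasis.hasSum_inner_mul_inner u v
  simpa only [sineBasis_apply, ← sineCoeff_eq_inner, real_inner_comm (sineFn _) u] using this

lemma hasSum_sineCoeff_sq (v : L2D) : HasSum (fun k => sineCoeff k v ^ 2) (‖v‖ ^ 2) := by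
  simpa only [sq, real_inner_self_eq_norm_mul_norm] using hasSum_sineCoeff_mul v v

lemma ext_sineCoeff {u v : L2D} (h : ∀ k, sineCoeff k u = sineCoeff k v) : u = v := by
  rw [← sub_eq_zero]
  refine eq_zero_of_sineCoeff_eq_zero fun k => ?_
  rw [sineCoeff_eq_inner, inner_sub_right, ← sineCoeff_eq_inner, ← sineCoeff_eq_inner, h, sub_self]

@[simp] lemma sineCoeff_add (k : ℕ) (u v : L2D) :
    sineCoeff k (u + v) = sineCoeff k u + sineCoeff k v := by
  simp only [sineCoeff_eq_inner, inner_add_right]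

@[simp] lemma sineCoeff_sub (k : ℕ) (u v : L2D) :
    sineCoeff k (u - v) = sineCoeff k u - sineCoeff k v := by
  simp only [sineCoeff_eq_inner, inner_sub_right]

@[simp] lemma sineCoeff_smul (k : ℕ) (a : ℝ) (v : L2D) :
    sineCoeff k (a • v) = a * sineCoeff k v := by
  simp only [sineCoeff_eq_inner, real_inner_smul_right]

@[simp] lemma sineCoeff_zero (k : ℕ) : sineCoeff k 0 = 0 := by
  simp only [sineCoeff_eq_inner, inner_zero_right]

/-- Every square-summable sequence is the sequence of sine coefficients of some `v ∈ L²(0,1)`. -/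
lemma exists_sineCoeff_eq {c : ℕ → ℝ} (hc : Summable fun k => c k ^ 2) :
    ∃ v : L2D, ∀ k, sineCoeff k v = c k := by
  have hmem : Memℓp c 2 := by
    refine memℓp_gen ?_
    simpa using hc
  refine ⟨sineBasis.repr.symm ⟨c, hmem⟩, fun k => ?_⟩
  rw [← sineBasis_repr, LinearIsometryEquiv.apply_symm_apply]

/-! ### The solution operator of `u'' = g`, `u(0) = u(1) = 0` -/

/-- Primitive of `g` vanishing at `0`. -/
noncomputable def prim (g : L2D) (x : ℝ) : ℝ := ∫ t in (0 : ℝ)..x, extZero g t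

/-- Second primitive of `g`. -/
noncomputable def primTwo (g : L2D) (x : ℝ) : ℝ := ∫ t in (0 : ℝ)..x, prim g t

/-- Continuous representative of the solution of `u'' = g`, `u(0) = u(1) = 0`. -/
noncomputable def dirichletFun (g : L2D) (x : ℝ) : ℝ := primTwo g x - primTwo g 1 * x

lemma continuous_prim (g : L2D) : Continuous (prim g) :=
  intervalIntegral.continuous_primitive (fun _ _ => (integrable_extZero g).intervalIntegrable) 0

lemma hasDerivAt_primTwo (g : L2D) (x : ℝ) : HasDerivAt (primTwo g) (prim g x) x :=
  intervalIntegral.integral_hasDerivAt_right ((continuous_prim g).intervalIntegrable _ _)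
    ((continuous_prim g).stronglyMeasurableAtFilter _ _) (continuous_prim g).continuousAt

lemma hasDerivAt_dirichletFun (g : L2D) (x : ℝ) :
    HasDerivAt (dirichletFun g) (prim g x - primTwo g 1) x := by
  have h := (hasDerivAt_primTwo g x).sub ((hasDerivAt_id x).const_mul (primTwo g 1))
  rw [mul_one] at h
  exact h

lemma continuous_dirichletFun (g : L2D) : Continuous (dirichletFun g) :=
  continuous_iff_continuousAt.mpr fun x => (hasDerivAt_dirichletFun g x).continuousAt

lemma continuous_dirichletFun_deriv (g : L2D) : Continuous fun x => prim g x - primTwo g 1 :=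
  (continuous_prim g).sub continuous_const

lemma dirichletFun_zero (g : L2D) : dirichletFun g 0 = 0 := by simp [dirichletFun, primTwo]

lemma dirichletFun_one (g : L2D) : dirichletFun g 1 = 0 := by simp [dirichletFun]

/-- The solution `u ∈ L²(0,1)` of `u'' = g`, `u(0) = u(1) = 0`. -/
noncomputable def dirichlet (g : L2D) : L2D := ofCont _ (continuous_dirichletFun g)

/-- The first derivative of `dirichlet g`. -/
noncomputable def dirichletDeriv (g : L2D) : L2D := ofCont _ (continuous_dirichletFun_deriv g)

/-- Since `prim g` is only absolutely continuous, with derivative g almost everywhere, integration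
by parts is used in its absolutely continuous form. The constant c is kept free because the
derivative of `dirichletFun g` is `prim g` minus a constant. -/
lemma integral_prim_mul_deriv (g : L2D) {ψ ψ' : ℝ → ℝ} (hψ : ∀ x, HasDerivAt ψ (ψ' x) x)
    (hc : Continuous ψ') (c : ℝ) :
    ∫ x in (0 : ℝ)..1, (prim g x - c) * ψ' x =
      (prim g 1 - c) * ψ 1 + c * ψ 0 - ∫ y in Ioo (0 : ℝ) 1, g y * ψ y := by
  have hg : IntervalIntegrable (extZero g) volume 0 1 := (integrable_extZero g).intervalIntegrable
  have hd : deriv ψ = ψ' := funext fun x => (hψ x).deriv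
  have hψ1 : ContDiff ℝ 1 ψ := contDiff_one_iff_deriv.mpr
    ⟨fun x => (hψ x).differentiableAt, hd ▸ hc⟩
  have hac := (hg.absolutelyContinuousOnInterval_intervalIntegral (c := 0) (by simp)).integral_mul_deriv_eq_deriv_mul
    (g := ψ) hψ1.contDiffOn.absolutelyContinuousOnInterval
  rw [hd] at hac
  have hae : ∫ x in (0 : ℝ)..1, deriv (fun x => ∫ t in (0 : ℝ)..x, extZero g t) x * ψ x =
      ∫ x in (0 : ℝ)..1, extZero g x * ψ x := by
    refine intervalIntegral.integral_congr_ae ?_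
    filter_upwards [hg.ae_hasDerivAt_integral] with x hx hx1
    rw [(hx (uIoc_subset_uIcc hx1) 0 (by simp)).deriv]
  rw [hae, intervalIntegral_extZero_mul] at hac
  have h0 : ∫ x in (0 : ℝ)..1, ψ' x = ψ 1 - ψ 0 :=
    intervalIntegral.integral_eq_sub_of_hasDerivAt (fun x _ => hψ x) (hc.intervalIntegrable _ _)
  simp only [sub_mul]
  have hi1 : Continuous fun x => prim g x * ψ' x := (continuous_prim g).mul hc
  have hi2 : Continuous fun x => c * ψ' x := continuous_const.mul hc
  rw [intervalIntegral.integral_sub (hi1.intervalIntegrable _ _) (hi2.intervalIntegrable _ _),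
    intervalIntegral.integral_const_mul, h0]
  have : ∫ x in (0 : ℝ)..1, prim g x * ψ' x =
      prim g 1 * ψ 1 - prim g 0 * ψ 0 - ∫ y in Ioo (0 : ℝ) 1, g y * ψ y := hac
  rw [this]
  simp only [prim, intervalIntegral.integral_same]
  ring

lemma integral_dirichletFun_mul_deriv (g : L2D) {ψ ψ' : ℝ → ℝ} (hψ : ∀ x, HasDerivAt ψ (ψ' x) x)
    (hc : Continuous ψ') :
    ∫ x in (0 : ℝ)..1, dirichletFun g x * ψ' x =
      -∫ x in (0 : ℝ)..1, (prim g x - primTwo g 1) * ψ x := by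
  rw [intervalIntegral.integral_mul_deriv_eq_deriv_mul (fun x _ => hasDerivAt_dirichletFun g x)
    (fun x _ => hψ x) ((continuous_dirichletFun_deriv g).intervalIntegrable _ _)
    (hc.intervalIntegrable _ _), dirichletFun_zero, dirichletFun_one]
  ring

/-- Two integrations by parts against the sine; one loses its boundary terms because the sine
vanishes at 0 and 1, the other because `dirichletFun g` does. -/
lemma sineCoeff_dirichlet (g : L2D) (k : ℕ) :
    sineCoeff k g = -lam k ^ 2 * sineCoeff k (dirichlet g) := by
  set a : ℝ := Real.sqrt 2 with ha
  have h1 : ∀ x, HasDerivAt (fun y => a * Real.sin (lam k * y)) (a * (lam k * Real.cos (lam k * x))) x := by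
    intro x
    have := (((hasDerivAt_id x).const_mul (lam k)).sin).const_mul a
    simpa [mul_comm] using this
  have h2 : ∀ x, HasDerivAt (fun y => a * (lam k * Real.cos (lam k * y)))
      (-lam k ^ 2 * (a * Real.sin (lam k * x))) x := by
    intro x
    have := ((((hasDerivAt_id x).const_mul (lam k)).cos).const_mul (lam k)).const_mul a
    refine this.congr_deriv ?_
    simp only [id]; ring
  have e1 := integral_prim_mul_deriv g h1 (by fun_prop) (primTwo g 1)
  have e2 := integral_dirichletFun_mul_deriv g h2 (by fun_prop)
  rw [e1, mul_one, mul_zero, sin_lam, Real.sin_zero, mul_zero, mul_zero, mul_zero, zero_add,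
    zero_sub, neg_neg] at e2
  rw [sineCoeff, ← e2, sineCoeff, dirichlet, integral_ofCont_mul, setIntegral_Ioo_eq,
    ← intervalIntegral.integral_const_mul]
  exact intervalIntegral.integral_congr fun x _ => by ring

/-- Integration by parts with the solution itself as test function. This controls odd-order
derivatives without a cosine basis. -/
lemma norm_dirichletDeriv_sq (g : L2D) :
    ‖dirichletDeriv g‖ ^ 2 = -inner ℝ (dirichlet g) g := by
  have e := integral_prim_mul_deriv g (hasDerivAt_dirichletFun g) (continuous_dirichletFun_deriv g)
    (primTwo g 1)
  rw [dirichletFun_zero, dirichletFun_one] at e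
  rw [norm_sq_eq_integral, dirichlet, inner_ofCont]
  have : ∫ y in Ioo (0 : ℝ) 1, dirichletDeriv g y ^ 2 =
      ∫ x in (0 : ℝ)..1, (prim g x - primTwo g 1) * (prim g x - primTwo g 1) := by
    rw [← setIntegral_Ioo_eq]
    refine integral_congr_ae ?_
    filter_upwards [coeFn_ofCont (continuous_dirichletFun_deriv g)] with y hy
    rw [dirichletDeriv, hy, sq]
  rw [this, e]
  ring

lemma vanishesAtEndpoints_dirichlet (g : L2D) : VanishesAtEndpoints (dirichlet g) :=
  ⟨dirichletFun g, (continuous_dirichletFun g).continuousOn, dirichletFun_zero g,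
    dirichletFun_one g, coeFn_ofCont _⟩

/-! ### Test functions -/

lemma IsTest.eq_zero {φ : ℝ → ℝ} (hφ : IsTest φ) {x : ℝ} (hx : x ∉ Ioo (0 : ℝ) 1) : φ x = 0 :=
  image_eq_zero_of_notMem_tsupport fun h => hx (hφ.2.2 h)

lemma IsTest.hasDerivAt {φ : ℝ → ℝ} (hφ : IsTest φ) (x : ℝ) : HasDerivAt φ (deriv φ x) x :=
  (hφ.1.differentiable (by simp) x).hasDerivAt

lemma IsTest.deriv {φ : ℝ → ℝ} (hφ : IsTest φ) : IsTest (deriv φ) :=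
  ⟨(contDiff_infty_iff_deriv.mp hφ.1).2, hφ.2.1.deriv,
    (tsupport_deriv_subset).trans hφ.2.2⟩

lemma IsTest.iteratedDeriv {φ : ℝ → ℝ} (hφ : IsTest φ) (n : ℕ) : IsTest (iteratedDeriv n φ) := by
  induction n with
  | zero => rwa [iteratedDeriv_zero]
  | succ n ih => rw [iteratedDeriv_succ]; exact ih.deriv

lemma IsTest.sub {φ ψ : ℝ → ℝ} (hφ : IsTest φ) (hψ : IsTest ψ) : IsTest (φ - ψ) :=
  ⟨hφ.1.sub hψ.1, hφ.2.1.sub hψ.2.1,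
    (tsupport_sub φ ψ).trans (union_subset hφ.2.2 hψ.2.2)⟩

lemma IsTest.const_mul {φ : ℝ → ℝ} (hφ : IsTest φ) (c : ℝ) : IsTest (fun x => c * φ x) :=
  ⟨contDiff_const.mul hφ.1, hφ.2.1.mul_left, (tsupport_mul_subset_right).trans hφ.2.2⟩

lemma IsTest.integrable_mul {φ : ℝ → ℝ} (hφ : IsTest φ) (u : L2D) :
    Integrable (fun y => u y * φ y) (volume.restrict (Ioo (0 : ℝ) 1)) :=
  integrable_mul_test u hφ.1.continuous hφ.2.1

lemma hasWeakDeriv_zero_self (u : L2D) : HasWeakDeriv 0 u u := by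
  intro φ _
  simp

lemma HasWeakDeriv.comp {m n : ℕ} {u v w : L2D} (h1 : HasWeakDeriv m u v)
    (h2 : HasWeakDeriv n v w) : HasWeakDeriv (m + n) u w := by
  intro φ hφ
  have e : _root_.iteratedDeriv (m + n) φ = _root_.iteratedDeriv m (_root_.iteratedDeriv n φ) := by
    simp only [iteratedDeriv_eq_iterate, Function.iterate_add_apply]
  rw [e, h1 _ (hφ.iteratedDeriv n), h2 φ hφ, pow_add, mul_assoc]

lemma hasWeakDeriv_one_dirichlet (g : L2D) : HasWeakDeriv 1 (dirichlet g) (dirichletDeriv g) := by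
  intro φ hφ
  rw [iteratedDeriv_one, dirichlet, dirichletDeriv, integral_ofCont_mul, integral_ofCont_mul,
    setIntegral_Ioo_eq, setIntegral_Ioo_eq,
    integral_dirichletFun_mul_deriv g hφ.hasDerivAt hφ.deriv.1.continuous]
  ring

lemma hasWeakDeriv_one_dirichletDeriv (g : L2D) : HasWeakDeriv 1 (dirichletDeriv g) g := by
  intro φ hφ
  rw [iteratedDeriv_one, dirichletDeriv, integral_ofCont_mul, setIntegral_Ioo_eq,
    integral_prim_mul_deriv g hφ.hasDerivAt hφ.deriv.1.continuous, hφ.eq_zero (by simp),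
    hφ.eq_zero (by simp)]
  ring

lemma hasWeakDeriv_two_dirichlet (g : L2D) : HasWeakDeriv 2 (dirichlet g) g :=
  (hasWeakDeriv_one_dirichlet g).comp (hasWeakDeriv_one_dirichletDeriv g)

/-- A test function of mean zero is the derivative of a test function. -/
lemma IsTest.exists_primitive {ψ : ℝ → ℝ} (hψ : IsTest ψ) (h0 : ∫ x in (0 : ℝ)..1, ψ x = 0) :
    ∃ φ, IsTest φ ∧ _root_.deriv φ = ψ := by
  obtain ⟨a, b, ha, hb, hab⟩ : ∃ a b : ℝ, 0 < a ∧ b < 1 ∧ tsupport ψ ⊆ Icc a b := by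
    rcases (tsupport ψ).eq_empty_or_nonempty with he | hne
    · exact ⟨1 / 2, 1 / 2, by norm_num, by norm_num, by simp [he]⟩
    · have hc : IsCompact (tsupport ψ) := hψ.2.1
      exact ⟨sInf (tsupport ψ), sSup (tsupport ψ), (hψ.2.2 (hc.sInf_mem hne)).1,
        (hψ.2.2 (hc.sSup_mem hne)).2, fun x hx =>
          ⟨csInf_le hc.bddBelow hx, le_csSup hc.bddAbove hx⟩⟩
  have hz : ∀ x, x ∉ Icc a b → ψ x = 0 := fun x hx =>
    image_eq_zero_of_notMem_tsupport fun h => hx (hab h)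
  have hcont : Continuous ψ := hψ.1.continuous
  have hd : ∀ x, HasDerivAt (fun x => ∫ t in (0 : ℝ)..x, ψ t) (ψ x) x := fun x =>
    intervalIntegral.integral_hasDerivAt_right (hcont.intervalIntegrable _ _)
      (hcont.stronglyMeasurableAtFilter _ _) hcont.continuousAt
  have hderiv : _root_.deriv (fun x => ∫ t in (0 : ℝ)..x, ψ t) = ψ := funext fun x => (hd x).deriv
  -- To the left of the support the primitive integrates zero; to the right it equals the full mean
  -- of ψ, which is zero.
  have hsupp : ∀ x, x ∉ Icc a b → ∫ t in (0 : ℝ)..x, ψ t = 0 := by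
    intro x hx
    rcases lt_or_ge x a with hxa | hxa
    · refine intervalIntegral.integral_zero_ae (Filter.Eventually.of_forall fun t ht => hz t fun h => ?_)
      rcases le_total 0 x with hx0 | hx0
      · rw [uIoc_of_le hx0] at ht; linarith [h.1, ht.2]
      · rw [uIoc_of_ge hx0] at ht; linarith [h.1, ht.2]
    · have hxb : b < x := by
        by_contra hcon
        exact hx ⟨hxa, not_lt.mp hcon⟩
      rw [← intervalIntegral.integral_add_adjacent_intervals (hcont.intervalIntegrable 0 1)
        (hcont.intervalIntegrable 1 x), h0, zero_add]
      refine intervalIntegral.integral_zero_ae (Filter.Eventually.of_forall fun t ht => hz t fun h => ?_)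
      rcases le_total 1 x with hx0 | hx0
      · rw [uIoc_of_le hx0] at ht; linarith [h.2, ht.1]
      · rw [uIoc_of_ge hx0] at ht; linarith [h.2, ht.1]
  refine ⟨_, ⟨contDiff_infty_iff_deriv.mpr ⟨fun x => (hd x).differentiableAt, by rw [hderiv]; exact hψ.1⟩,
    HasCompactSupport.intro isCompact_Icc hsupp, ?_⟩, hderiv⟩
  refine (closure_minimal (fun x hx => ?_) isClosed_Icc).trans
    (fun x hx => ⟨ha.trans_le hx.1, hx.2.trans_lt hb⟩ : Icc a b ⊆ Ioo 0 1)
  by_contra hcon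
  exact hx (hsupp x hcon)

lemma exists_isTest_integral_eq_one : ∃ η : ℝ → ℝ, IsTest η ∧ ∫ x in (0 : ℝ)..1, η x = 1 := by
  let f : ContDiffBump (1 / 2 : ℝ) := ⟨1 / 8, 1 / 4, by norm_num, by norm_num⟩
  have hsub : tsupport (f.normed volume) ⊆ Ioo (0 : ℝ) 1 := by
    rw [f.tsupport_normed_eq, Real.closedBall_eq_Icc]
    intro x hx
    have h1 := hx.1
    have h2 := hx.2
    simp only [f] at h1 h2
    constructor <;> linarith
  refine ⟨f.normed volume, ⟨f.contDiff_normed, f.hasCompactSupport_normed, hsub⟩, ?_⟩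
  rw [← setIntegral_Ioo_eq, setIntegral_eq_integral_of_forall_compl_eq_zero, f.integral_normed]
  intro x hx
  exact image_eq_zero_of_notMem_tsupport fun h => hx (hsub h)

/-- A function whose second generalized derivative vanishes is affine. -/
lemma HasWeakDeriv.exists_affine {u : L2D} (hu : HasWeakDeriv 2 u 0) :
    ∃ a b : ℝ, u = ofCont (fun x => a + b * x) (by fun_prop) := by
  obtain ⟨η, hη, hη1⟩ := exists_isTest_integral_eq_one
  set A := ∫ y in Ioo (0 : ℝ) 1, u y * η y with hA
  set B := ∫ y in Ioo (0 : ℝ) 1, u y * deriv η y with hB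
  set e := ∫ x in (0 : ℝ)..1, x * η x with he
  -- A weak derivative of order 0 is the function itself, so it suffices to test u against every ψ.
  -- Subtracting multiples of η and η' from ψ makes it a second derivative of a test function, and
  -- the hypothesis kills that part; the coefficients of the affine function are read off from what
  -- remains.
  refine ⟨A + B * e, -B, HasWeakDeriv.unique (hasWeakDeriv_zero_self u) fun ψ hψ => ?_⟩
  have hψi : ∀ a b : ℝ, IntervalIntegrable ψ volume a b := hψ.1.continuous.intervalIntegrable
  have hηi : ∀ a b : ℝ, IntervalIntegrable η volume a b := hη.1.continuous.intervalIntegrable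
  set c := ∫ x in (0 : ℝ)..1, ψ x with hc
  obtain ⟨φ₁, hφ₁, hd₁⟩ := (hψ.sub (hη.const_mul c)).exists_primitive (by
    simp only [Pi.sub_apply]
    rw [intervalIntegral.integral_sub (hψi _ _) ((hηi _ _).const_mul c),
      intervalIntegral.integral_const_mul, hη1, ← hc]
    ring)
  set d := ∫ x in (0 : ℝ)..1, φ₁ x with hd
  have hφ₁i : ∀ a b : ℝ, IntervalIntegrable φ₁ volume a b := hφ₁.1.continuous.intervalIntegrable
  obtain ⟨φ₂, hφ₂, hd₂⟩ := (hφ₁.sub (hη.const_mul d)).exists_primitive (by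
    simp only [Pi.sub_apply]
    rw [intervalIntegral.integral_sub (hφ₁i _ _) ((hηi _ _).const_mul d),
      intervalIntegral.integral_const_mul, hη1, ← hd]
    ring)
  have hdd : ∀ y, iteratedDeriv 2 φ₂ y = ψ y - c * η y - d * deriv η y := by
    intro y
    rw [iteratedDeriv_succ, iteratedDeriv_one, hd₂, deriv_sub (hφ₁.hasDerivAt y).differentiableAt
      (((hη.hasDerivAt y).const_mul d).differentiableAt), hd₁, ((hη.hasDerivAt y).const_mul d).deriv]
    rfl
  have hxψ : Continuous fun x => x * ψ x := continuous_id.mul hψ.1.continuous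
  have hd' : d = c * e - ∫ x in (0 : ℝ)..1, x * ψ x := by
    have hp := intervalIntegral.integral_mul_deriv_eq_deriv_mul (a := 0) (b := 1)
      (u := fun x : ℝ => x) (u' := fun _ => 1) (v := φ₁) (v' := deriv φ₁)
      (fun x _ => hasDerivAt_id x) (fun x _ => hφ₁.hasDerivAt x)
      (continuous_const.intervalIntegrable _ _) (hφ₁.deriv.1.continuous.intervalIntegrable _ _)
    rw [hφ₁.eq_zero (by simp), hd₁] at hp
    simp only [Pi.sub_apply, mul_sub, one_mul] at hp
    have h3 : ∀ x : ℝ, x * (c * η x) = c * (x * η x) := fun x => by ring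
    simp only [h3] at hp
    have hc1 : Continuous fun x => c * (x * η x) := continuous_const.mul (continuous_id.mul hη.1.continuous)
    rw [intervalIntegral.integral_sub (hxψ.intervalIntegrable _ _) (hc1.intervalIntegrable _ _),
      intervalIntegral.integral_const_mul, ← he, ← hd] at hp
    linarith
  have h0 := hu φ₂ hφ₂
  have hz : ∫ y in Ioo (0 : ℝ) 1, (0 : L2D) y * φ₂ y = 0 := by
    simpa using integral_smul_mul 0 (0 : L2D) φ₂
  simp only [hz, mul_zero, hdd, mul_sub] at h0
  have h4 : ∀ y, u y * (c * η y) = c * (u y * η y) := fun y => by ring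
  have h5 : ∀ y, u y * (d * deriv η y) = d * (u y * deriv η y) := fun y => by ring
  simp only [h4, h5] at h0
  have hi : Integrable (fun y => u y * ψ y - c * (u y * η y)) (volume.restrict (Ioo (0 : ℝ) 1)) :=
    (hψ.integrable_mul u).sub ((hη.integrable_mul u).const_mul c)
  rw [integral_sub hi
    ((hη.deriv.integrable_mul u).const_mul d), integral_sub (hψ.integrable_mul u)
    ((hη.integrable_mul u).const_mul c), integral_const_mul, integral_const_mul, ← hA, ← hB] at h0
  rw [iteratedDeriv_zero, pow_zero, one_mul, integral_ofCont_mul,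
    setIntegral_Ioo_eq fun y => (A + B * e + -B * y) * ψ y]
  have h6 : ∀ y, (A + B * e + -B * y) * ψ y = (A + B * e) * ψ y - B * (y * ψ y) := fun y => by ring
  simp only [h6]
  rw [intervalIntegral.integral_sub ((hψi _ _).const_mul _) ((hxψ.intervalIntegrable _ _).const_mul _),
    intervalIntegral.integral_const_mul, intervalIntegral.integral_const_mul, ← hc]
  linear_combination h0 + B * hd'

/-- The difference of the two functions has vanishing second derivative, hence is affine. Continuous
representatives that agree almost everywhere agree on all of [0,1], so the affine function is zero
at both endpoints. -/
lemma eq_dirichlet {u g : L2D} (hu : HasWeakDeriv 2 u g) (h0 : VanishesAtEndpoints u) :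
    u = dirichlet g := by
  have hw : HasWeakDeriv 2 (u + (-1 : ℝ) • dirichlet g) 0 := by
    have := hu.add ((hasWeakDeriv_two_dirichlet g).smul (-1))
    simpa using this
  obtain ⟨a, b, hab⟩ := hw.exists_affine
  obtain ⟨v, hv, hv0, hv1, hvu⟩ := h0
  have hae : v =ᵐ[volume.restrict (Icc (0 : ℝ) 1)] fun x => dirichletFun g x + (a + b * x) := by
    rw [← Measure.restrict_congr_set (Ioo_ae_eq_Icc (μ := volume))]
    have h1 : u = (ofCont (fun x => a + b * x) (by fun_prop) : L2D) + dirichlet g := by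
      rw [← hab]; simp
    have h2 := Lp.coeFn_add (ofCont (fun x => a + b * x) (by fun_prop) : L2D) (dirichlet g)
    rw [← h1] at h2
    filter_upwards [hvu, h2, coeFn_ofCont (f := fun x => a + b * x) (by fun_prop),
      coeFn_ofCont (continuous_dirichletFun g)] with x h3 h4 h5 h6
    rw [← h3, h4, Pi.add_apply, h5, dirichlet, h6]
    ring
  have heq := Measure.eqOn_Icc_of_ae_eq volume zero_ne_one hae hv
    (((continuous_dirichletFun g).add (by fun_prop)).continuousOn)
  have e0 := heq (left_mem_Icc.mpr zero_le_one)
  have e1 := heq (right_mem_Icc.mpr zero_le_one)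
  simp only [hv0, hv1, dirichletFun_zero, dirichletFun_one] at e0 e1
  have ha : a = 0 := by linarith
  have hb : b = 0 := by linarith
  subst ha hb
  have hz : (ofCont (fun x => (0 : ℝ) + 0 * x) (by fun_prop) : L2D) = 0 := by
    refine Lp.ext ?_
    filter_upwards [coeFn_ofCont (f := fun x => (0 : ℝ) + 0 * x) (by fun_prop),
      Lp.coeFn_zero ℝ 2 (volume.restrict (Ioo (0 : ℝ) 1))] with x h1 h2
    rw [h1, h2]; simp
  rw [hz] at hab
  simpa [← sub_eq_add_neg, sub_eq_zero] using hab

/-! ### The Dirichlet Laplacian in terms of sine coefficients -/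

/-- `u ∈ H²(0,1) ∩ H¹₀(0,1)` and `g = ∂²u`, expressed by sine coefficients. -/
def IsLaplace (u g : L2D) : Prop := ∀ k, sineCoeff k g = -lam k ^ 2 * sineCoeff k u

lemma IsLaplace.eq_dirichlet {u g : L2D} (h : IsLaplace u g) : u = dirichlet g := by
  refine ext_sineCoeff fun k => ?_
  have h1 := sineCoeff_dirichlet g k
  rw [h k] at h1
  have : -lam k ^ 2 ≠ 0 := neg_ne_zero.mpr (pow_ne_zero _ (lam_pos k).ne')
  exact mul_left_cancel₀ this h1

lemma isLaplace_dirichlet (g : L2D) : IsLaplace (dirichlet g) g := sineCoeff_dirichlet g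

lemma IsLaplace.hasWeakDeriv {u g : L2D} (h : IsLaplace u g) : HasWeakDeriv 2 u g := by
  rw [h.eq_dirichlet]; exact hasWeakDeriv_two_dirichlet g

lemma IsLaplace.vanishes {u g : L2D} (h : IsLaplace u g) : VanishesAtEndpoints u := by
  rw [h.eq_dirichlet]; exact vanishesAtEndpoints_dirichlet g

lemma IsLaplace.exists_deriv {u g : L2D} (h : IsLaplace u g) :
    ∃ d : L2D, HasWeakDeriv 1 u d ∧ ‖d‖ ^ 2 = -inner ℝ u g := by
  refine ⟨dirichletDeriv g, ?_, ?_⟩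
  · rw [h.eq_dirichlet]; exact hasWeakDeriv_one_dirichlet g
  · rw [norm_dirichletDeriv_sq, ← h.eq_dirichlet]

lemma HasWeakDeriv.weakDeriv_eq {n : ℕ} {u g : L2D} (h : HasWeakDeriv n u g) :
    weakDeriv n u = g := by
  have hex : ∃ g : L2D, HasWeakDeriv n u g := ⟨g, h⟩
  rw [weakDeriv, dif_pos hex]
  exact hex.choose_spec.unique h

lemma IsLaplace.weakDeriv_two {u g : L2D} (h : IsLaplace u g) : weakDeriv 2 u = g :=
  h.hasWeakDeriv.weakDeriv_eq

lemma HasWeakDeriv.isLaplace {u g : L2D} (h : HasWeakDeriv 2 u g) (h0 : VanishesAtEndpoints u) :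
    IsLaplace u g := by
  have := isLaplace_dirichlet g
  rwa [← eq_dirichlet h h0] at this

lemma isLaplace_weakDeriv {u : L2D} (h : MemH 2 u) (h0 : VanishesAtEndpoints u) :
    IsLaplace u (weakDeriv 2 u) := by
  obtain ⟨g, hg⟩ := h 2 le_rfl
  rw [hg.weakDeriv_eq]
  exact hg.isLaplace h0

lemma IsLaplace.add {u v g k : L2D} (hu : IsLaplace u g) (hv : IsLaplace v k) :
    IsLaplace (u + v) (g + k) := fun n => by
  rw [sineCoeff_add, sineCoeff_add, hu n, hv n]; ring

lemma IsLaplace.sub {u v g k : L2D} (hu : IsLaplace u g) (hv : IsLaplace v k) :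
    IsLaplace (u - v) (g - k) := fun n => by
  rw [sineCoeff_sub, sineCoeff_sub, hu n, hv n]; ring

lemma IsLaplace.smul {u g : L2D} (a : ℝ) (hu : IsLaplace u g) : IsLaplace (a • u) (a • g) :=
  fun n => by rw [sineCoeff_smul, sineCoeff_smul, hu n]; ring

/-- The multiplier -λ_k² can be moved from one factor to the other in Parseval's identity: Green's
formula without boundary terms. -/
lemma IsLaplace.inner_comm {u v g k : L2D} (hu : IsLaplace u g) (hv : IsLaplace v k) :
    inner ℝ g v = inner ℝ u k := by
  refine (hasSum_sineCoeff_mul g v).unique ?_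
  convert hasSum_sineCoeff_mul u k using 2 with n
  rw [hu n, hv n]; ring

lemma IsLaplace.memH01 {u g : L2D} (h : IsLaplace u g) : MemH01 u := by
  refine ⟨fun n hn => ?_, h.vanishes⟩
  obtain ⟨d, hd, -⟩ := h.exists_deriv
  interval_cases n
  · exact ⟨u, hasWeakDeriv_zero_self u⟩
  · exact ⟨d, hd⟩

lemma IsLaplace.memH {u g : L2D} (h : IsLaplace u g) : MemH 2 u := by
  intro n hn
  rcases Nat.lt_or_ge n 2 with h1 | h1
  · exact h.memH01.1 n (by omega)
  · obtain rfl : n = 2 := le_antisymm hn h1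
    exact ⟨g, h.hasWeakDeriv⟩

/-! ### The scale of norms defined by sine coefficients -/

lemma hdot_term_nonneg (s : ℝ) (v : L2D) (k : ℕ) : 0 ≤ lam k ^ (2 * s) * sineCoeff k v ^ 2 :=
  mul_nonneg (Real.rpow_nonneg (lam_pos k).le _) (sq_nonneg _)

lemma hdotNorm_nonneg (s : ℝ) (v : L2D) : 0 ≤ hdotNorm s v := Real.sqrt_nonneg _

lemma hdotNorm_sq (s : ℝ) (v : L2D) :
    hdotNorm s v ^ 2 = ∑' k : ℕ, lam k ^ (2 * s) * sineCoeff k v ^ 2 :=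
  Real.sq_sqrt (tsum_nonneg (hdot_term_nonneg s v))

lemma MemHdot.hasSum {s : ℝ} {v : L2D} (h : MemHdot s v) :
    HasSum (fun k : ℕ => lam k ^ (2 * s) * sineCoeff k v ^ 2) (hdotNorm s v ^ 2) := by
  rw [hdotNorm_sq]
  exact Summable.hasSum h

lemma hdot_term_mono {s t : ℝ} (hst : s ≤ t) (v : L2D) (k : ℕ) :
    lam k ^ (2 * s) * sineCoeff k v ^ 2 ≤ lam k ^ (2 * t) * sineCoeff k v ^ 2 :=
  mul_le_mul_of_nonneg_right
    (Real.rpow_le_rpow_of_exponent_le (one_le_lam k) (by linarith)) (sq_nonneg _)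

lemma MemHdot.mono {s t : ℝ} {v : L2D} (h : MemHdot t v) (hst : s ≤ t) : MemHdot s v :=
  Summable.of_nonneg_of_le (hdot_term_nonneg s v) (hdot_term_mono hst v) h

lemma MemHdot.hdotNorm_mono {s t : ℝ} {v : L2D} (h : MemHdot t v) (hst : s ≤ t) :
    hdotNorm s v ≤ hdotNorm t v :=
  Real.sqrt_le_sqrt (Summable.tsum_le_tsum (hdot_term_mono hst v) (h.mono hst) h)

lemma memHdot_of_hasSum {s : ℝ} {v : L2D} {X : ℝ}
    (h : HasSum (fun k : ℕ => lam k ^ (2 * s) * sineCoeff k v ^ 2) X) :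
    MemHdot s v ∧ hdotNorm s v ^ 2 = X :=
  ⟨h.summable, by rw [hdotNorm_sq, h.tsum_eq]⟩

lemma lam_rpow_natCast (n : ℕ) (k : ℕ) : lam k ^ (2 * (n : ℝ)) = lam k ^ (2 * n) := by
  rw [← Real.rpow_natCast]
  push_cast
  rfl

lemma memHdot_zero (v : L2D) : MemHdot 0 v ∧ hdotNorm 0 v = ‖v‖ := by
  have h := memHdot_of_hasSum (s := 0) (v := v) (X := ‖v‖ ^ 2) (by
    simpa using hasSum_sineCoeff_sq v)
  exact ⟨h.1, (sq_eq_sq₀ (hdotNorm_nonneg _ _) (norm_nonneg _)).mp h.2⟩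

lemma IsLaplace.memHdot_two {v a : L2D} (h : IsLaplace v a) :
    MemHdot 2 v ∧ hdotNorm 2 v = ‖a‖ := by
  have h2 := memHdot_of_hasSum (s := 2) (v := v) (X := ‖a‖ ^ 2) (by
    convert hasSum_sineCoeff_sq a using 2 with k
    have := lam_rpow_natCast 2 k
    push_cast at this
    rw [this, h k]; ring)
  exact ⟨h2.1, (sq_eq_sq₀ (hdotNorm_nonneg _ _) (norm_nonneg _)).mp h2.2⟩

lemma IsLaplace.hdotNorm_one_sq {v a : L2D} (h : IsLaplace v a) :
    hdotNorm 1 v ^ 2 = -inner ℝ v a := by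
  refine (memHdot_of_hasSum (s := 1) (v := v) ?_).2
  refine (hasSum_sineCoeff_mul v a).neg.congr_fun fun k => ?_
  have := lam_rpow_natCast 1 k
  push_cast at this
  rw [this, h k]; ring

lemma IsLaplace.hdotNorm_three_sq {v a b : L2D} (h : IsLaplace v a) (h' : IsLaplace a b) :
    hdotNorm 3 v ^ 2 = -inner ℝ a b := by
  refine (memHdot_of_hasSum (s := 3) (v := v) ?_).2
  refine (hasSum_sineCoeff_mul a b).neg.congr_fun fun k => ?_
  have := lam_rpow_natCast 3 k
  push_cast at this
  rw [this, h' k, h k]; ring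

lemma IsLaplace.memHdot_four {v a b : L2D} (h : IsLaplace v a) (h' : IsLaplace a b) :
    MemHdot 4 v ∧ hdotNorm 4 v = ‖b‖ := by
  have h2 := memHdot_of_hasSum (s := 4) (v := v) (X := ‖b‖ ^ 2) (by
    convert hasSum_sineCoeff_sq b using 2 with k
    have := lam_rpow_natCast 4 k
    push_cast at this
    rw [this, h' k, h k]; ring)
  exact ⟨h2.1, (sq_eq_sq₀ (hdotNorm_nonneg _ _) (norm_nonneg _)).mp h2.2⟩

lemma MemHdot.exists_isLaplace {v : L2D} (h : MemHdot 4 v) :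
    ∃ a b, IsLaplace v a ∧ IsLaplace a b := by
  have h2 : ∀ n : ℕ, (n : ℝ) ≤ 4 →
      Summable fun k => (lam k ^ n * sineCoeff k v) ^ 2 := by
    intro n hn
    have := h.mono hn
    rw [MemHdot] at this
    convert this using 2 with k
    rw [lam_rpow_natCast]; ring
  obtain ⟨a, ha⟩ := exists_sineCoeff_eq (c := fun k => -(lam k ^ 2 * sineCoeff k v)) (by
    simpa only [neg_sq] using h2 2 (by norm_num))
  obtain ⟨b, hb⟩ := exists_sineCoeff_eq (h2 4 (by norm_num))
  exact ⟨a, b, fun k => by rw [ha k]; ring, fun k => by rw [ha k, hb k]; ring⟩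

lemma IsLaplace.ellipticOp_eq {μ : ℝ} {v a b : L2D} (h : IsLaplace v a) (h' : IsLaplace a b) :
    ellipticOp μ v = b + μ • a := by
  rw [ellipticOp, h.weakDeriv_two, (h.hasWeakDeriv.comp h'.hasWeakDeriv).weakDeriv_eq]

lemma IsLaplace.norm_le {v a : L2D} (h : IsLaplace v a) : ‖v‖ ≤ ‖a‖ := by
  rw [← h.memHdot_two.2, ← (memHdot_zero v).2]
  exact h.memHdot_two.1.hdotNorm_mono (by norm_num)

/-- Sobolev norms are bounded by the norms defined by sine coefficients. -/
lemma IsLaplace.sobolevNorm_le {v a b : L2D} (h : IsLaplace v a) (h' : IsLaplace a b) {n : ℕ}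
    (hn : n ≤ 4) : MemH n v ∧ sobolevNorm n v ≤ 3 * hdotNorm n v := by
  obtain ⟨d, hd, hdn⟩ := h.exists_deriv
  obtain ⟨e, he, hen⟩ := h'.exists_deriv
  have w1 := hd
  have w2 := h.hasWeakDeriv
  have w3 := h.hasWeakDeriv.comp he
  have w4 := h.hasWeakDeriv.comp h'.hasWeakDeriv
  have h4 := h.memHdot_four h'
  have key : ∀ m ≤ 4, ∃ g, HasWeakDeriv m v g ∧ ‖g‖ = hdotNorm m v := by
    have hs : ∀ (g : L2D) (s : ℝ), ‖g‖ ^ 2 = hdotNorm s v ^ 2 → ‖g‖ = hdotNorm s v :=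
      fun g s hg => (sq_eq_sq₀ (norm_nonneg _) (hdotNorm_nonneg _ _)).mp hg
    intro m hm
    interval_cases m
    · exact ⟨v, hasWeakDeriv_zero_self v, by simp [(memHdot_zero v).2]⟩
    · exact ⟨d, w1, hs _ _ (by push_cast; rw [hdn, h.hdotNorm_one_sq])⟩
    · exact ⟨a, w2, by push_cast; rw [h.memHdot_two.2]⟩
    · exact ⟨e, w3, hs _ _ (by push_cast; rw [hen, h.hdotNorm_three_sq h'])⟩
    · exact ⟨b, w4, by push_cast; rw [h4.2]⟩
  refine ⟨fun m hm => ?_, ?_⟩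
  · obtain ⟨g, hg, -⟩ := key m (hm.trans hn)
    exact ⟨g, hg⟩
  · rw [sobolevNorm]
    refine Real.sqrt_le_iff.mpr ⟨by positivity [hdotNorm_nonneg n v], ?_⟩
    have hb : ∀ m ∈ Finset.range (n + 1), ‖weakDeriv m v‖ ^ 2 ≤ hdotNorm n v ^ 2 := by
      intro m hm
      have hm' : m ≤ n := Nat.lt_succ_iff.mp (Finset.mem_range.mp hm)
      obtain ⟨g, hg, hgn⟩ := key m (hm'.trans hn)
      rw [hg.weakDeriv_eq, hgn]
      have : MemHdot n v := h4.1.mono (by exact_mod_cast hn)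
      exact pow_le_pow_left₀ (hdotNorm_nonneg _ _)
        (this.hdotNorm_mono (by exact_mod_cast hm')) 2
    refine (Finset.sum_le_card_nsmul _ _ _ hb).trans ?_
    rw [Finset.card_range, nsmul_eq_mul, mul_pow]
    -- The constant 3 is generous: there are at most five derivatives, and 5 ≤ 9.
    have : ((n + 1 : ℕ) : ℝ) ≤ 3 ^ 2 := by
      have : (n : ℝ) ≤ 4 := by exact_mod_cast hn
      push_cast; linarith
    exact mul_le_mul_of_nonneg_right this (sq_nonneg _)

lemma norm_weakDeriv_le_sobolevNorm {n m : ℕ} (hm : m ≤ n) (v : L2D) :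
    ‖weakDeriv m v‖ ≤ sobolevNorm n v := by
  refine Real.le_sqrt_of_sq_le ?_
  exact Finset.single_le_sum (f := fun m => ‖weakDeriv m v‖ ^ 2) (fun _ _ => sq_nonneg _)
    (Finset.mem_range.mpr (Nat.lt_succ_of_le hm))

/-! ### Piecewise polynomials -/

section Partition

variable {N : ℕ} {x : Fin (N + 1) → ℝ} {h : ℝ}

lemma IsPartition.mem_Icc (hx : IsPartition N x h) (i : Fin (N + 1)) : x i ∈ Icc (0 : ℝ) 1 :=
  ⟨hx.1 ▸ hx.2.2.1.monotone (Fin.zero_le i), hx.2.1 ▸ hx.2.2.1.monotone (Fin.le_last i)⟩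

lemma IsPartition.lt (hx : IsPartition N x h) (j : Fin N) : x j.castSucc < x j.succ :=
  hx.2.2.1 Fin.castSucc_lt_succ

lemma IsPartition.sub_le (hx : IsPartition N x h) (j : Fin N) : x j.succ - x j.castSucc ≤ h :=
  hx.2.2.2.2 ⟨j, rfl⟩

lemma IsPartition.pos (hx : IsPartition N x h) : 0 < h := by
  obtain ⟨j, hj⟩ := hx.2.2.2.1
  rw [← hj]
  exact sub_pos.mpr (hx.lt j)

lemma IsPartition.Ioo_subset (hx : IsPartition N x h) (j : Fin N) :
    Ioo (x j.castSucc) (x j.succ) ⊆ Ioo 0 1 :=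
  Ioo_subset_Ioo (hx.mem_Icc _).1 (hx.mem_Icc _).2

lemma IsPartition.eq_of_mem (hx : IsPartition N x h) {i j : Fin N} {y : ℝ}
    (hi : y ∈ Ioo (x i.castSucc) (x i.succ)) (hj : y ∈ Ioo (x j.castSucc) (x j.succ)) : i = j := by
  have key : ∀ i j : Fin N, y ∈ Ioo (x i.castSucc) (x i.succ) →
      y ∈ Ioo (x j.castSucc) (x j.succ) → ¬ i < j := by
    intro i j hi hj hij
    have : x i.succ ≤ x j.castSucc := hx.2.2.1.monotone (Fin.succ_le_castSucc_iff.mpr hij)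
    linarith [hi.2, hj.1]
  exact le_antisymm (not_lt.mp (key j i hj hi)) (not_lt.mp (key i j hi hj))

lemma IsPartition.ae_exists_mem (hx : IsPartition N x h) :
    ∀ᵐ y ∂(volume.restrict (Ioo (0 : ℝ) 1)), ∃ j : Fin N, y ∈ Ioo (x j.castSucc) (x j.succ) := by
  have hnull : ∀ᵐ y ∂(volume : Measure ℝ), y ∉ range x := (finite_range x).countable.ae_notMem _
  filter_upwards [ae_restrict_mem measurableSet_Ioo, ae_restrict_of_ae hnull] with y hy hyx
  have key : ∀ i : Fin (N + 1), y < x i → ∃ j : Fin N, y ∈ Ioo (x j.castSucc) (x j.succ) := by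
    intro i
    induction i using Fin.induction with
    | zero => intro h0; rw [hx.1] at h0; exact absurd hy.1 (not_lt.mpr h0.le)
    | succ i ih =>
      intro hi
      rcases lt_trichotomy y (x i.castSucc) with h1 | h1 | h1
      · exact ih h1
      · exact absurd ⟨_, h1.symm⟩ hyx
      · exact ⟨i, h1, hi⟩
  exact key (Fin.last N) (hx.2.1 ▸ hy.2)

lemma sum_sub_castSucc (N : ℕ) (p : Fin (N + 1) → ℝ) :
    ∑ j : Fin N, (p j.succ - p j.castSucc) = p (Fin.last N) - p 0 := by
  induction N with
  | zero => simp
  | succ N ih =>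
    rw [Fin.sum_univ_castSucc]
    have := ih fun i => p i.castSucc
    simp only [Fin.succ_castSucc] at this ⊢
    rw [this]
    simp

lemma IsPartition.sum_integral (hx : IsPartition N x h) {G : ℝ → ℝ}
    (hG : IntervalIntegrable G volume 0 1) :
    ∑ j : Fin N, ∫ y in (x j.castSucc)..(x j.succ), G y = ∫ y in (0 : ℝ)..1, G y := by
  have hi : ∀ i, IntervalIntegrable G volume 0 (x i) := fun i =>
    hG.mono_set (uIcc_subset_uIcc left_mem_uIcc (by rw [uIcc_of_le zero_le_one]; exact hx.mem_Icc i))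
  have e : ∀ j : Fin N, ∫ y in (x j.castSucc)..(x j.succ), G y =
      (∫ y in (0 : ℝ)..(x j.succ), G y) - ∫ y in (0 : ℝ)..(x j.castSucc), G y := fun j =>
    (intervalIntegral.integral_interval_sub_left (hi _) (hi _)).symm
  simp only [e]
  rw [sum_sub_castSucc N fun i => ∫ y in (0 : ℝ)..(x i), G y, hx.1, hx.2.1,
    intervalIntegral.integral_same, sub_zero]

/-- The function that equals `p j` on the `j`-th subinterval. -/
noncomputable def piecewiseFun (x : Fin (N + 1) → ℝ) (p : Fin N → ℝ[X]) (y : ℝ) : ℝ :=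
  ∑ j : Fin N, (Ioo (x j.castSucc) (x j.succ)).indicator (fun y => (p j).eval y) y

lemma memLp_piecewiseFun (x : Fin (N + 1) → ℝ) (p : Fin N → ℝ[X]) :
    MemLp (piecewiseFun x p) 2 (volume.restrict (Ioo (0 : ℝ) 1)) :=
  memLp_finsetSum _ fun j _ =>
    (memLp_of_continuous (p j).continuous).indicator measurableSet_Ioo

/-- `piecewiseFun` as an element of `L²(0,1)`. -/
noncomputable def piecewiseLp (x : Fin (N + 1) → ℝ) (p : Fin N → ℝ[X]) : L2D :=
  (memLp_piecewiseFun x p).toLp _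

lemma IsPartition.piecewiseFun_eq (hx : IsPartition N x h) (p : Fin N → ℝ[X]) {j : Fin N} {y : ℝ}
    (hy : y ∈ Ioo (x j.castSucc) (x j.succ)) : piecewiseFun x p y = (p j).eval y := by
  rw [piecewiseFun, Finset.sum_eq_single j, indicator_of_mem hy]
  · exact fun i _ hij => indicator_of_notMem (fun hi => hij (hx.eq_of_mem hi hy)) _
  · simp

lemma coeFn_piecewiseLp (x : Fin (N + 1) → ℝ) (p : Fin N → ℝ[X]) :
    piecewiseLp x p =ᵐ[volume.restrict (Ioo (0 : ℝ) 1)] piecewiseFun x p := MemLp.coeFn_toLp _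

/-- The linear map from families of polynomials to piecewise polynomials. -/
noncomputable def piecewiseLinear (x : Fin (N + 1) → ℝ) (r : ℕ) :
    (Fin N → degreeLT ℝ (r + 1)) →ₗ[ℝ] L2D where
  toFun p := piecewiseLp x fun j => (p j : ℝ[X])
  map_add' p q := by
    refine Lp.ext ?_
    filter_upwards [coeFn_piecewiseLp x fun j => (p j : ℝ[X]),
      coeFn_piecewiseLp x fun j => (q j : ℝ[X]),
      coeFn_piecewiseLp x fun j => ((p + q) j : ℝ[X]),
      Lp.coeFn_add (piecewiseLp x fun j => (p j : ℝ[X])) (piecewiseLp x fun j => (q j : ℝ[X]))]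
      with y h1 h2 h3 h4
    rw [h3, h4, Pi.add_apply, h1, h2, piecewiseFun, piecewiseFun, piecewiseFun,
      ← Finset.sum_add_distrib]
    refine Finset.sum_congr rfl fun j _ => ?_
    by_cases hy : y ∈ Ioo (x j.castSucc) (x j.succ)
    · simp only [indicator_of_mem hy, Pi.add_apply, Submodule.coe_add, eval_add]
    · simp only [indicator_of_notMem hy, add_zero]
  map_smul' c p := by
    refine Lp.ext ?_
    filter_upwards [coeFn_piecewiseLp x fun j => (p j : ℝ[X]),
      coeFn_piecewiseLp x fun j => ((c • p) j : ℝ[X]),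
      Lp.coeFn_smul c (piecewiseLp x fun j => (p j : ℝ[X]))]
      with y h1 h3 h4
    rw [h3, RingHom.id_apply, h4, Pi.smul_apply, h1, piecewiseFun, piecewiseFun, Finset.smul_sum]
    refine Finset.sum_congr rfl fun j _ => ?_
    by_cases hy : y ∈ Ioo (x j.castSucc) (x j.succ)
    · simp only [indicator_of_mem hy, Pi.smul_apply, Submodule.coe_smul, eval_smul]
    · simp only [indicator_of_notMem hy, smul_zero]

/-- Every spline is the image of a family of polynomials of bounded degree, one for each
subinterval, under a linear map. -/
lemma IsPartition.finiteDimensional (hx : IsPartition N x h) (r : ℕ) :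
    FiniteDimensional ℝ (splineSpace r x) := by
  have hfin : FiniteDimensional ℝ (degreeLT ℝ (r + 1)) :=
    (degreeLTEquiv ℝ (r + 1)).symm.finiteDimensional
  have hle : splineSpace r x ≤ LinearMap.range (piecewiseLinear x r) := by
    intro u hu
    choose p hp hpe using hu.2.2
    have hmem : ∀ j, p j ∈ degreeLT ℝ (r + 1) := fun j => by
      rw [mem_degreeLT]
      exact degree_le_natDegree.trans_lt (by exact_mod_cast Nat.lt_succ_of_le (hp j))
    refine ⟨fun j => ⟨p j, hmem j⟩, Lp.ext ?_⟩
    filter_upwards [coeFn_piecewiseLp x p, ae_all_iff.mpr hpe, hx.ae_exists_mem]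
      with y h1 h2 h3
    obtain ⟨j, hj⟩ := h3
    rw [h2 j hj, ← hx.piecewiseFun_eq p hj, ← h1]
    rfl
  exact Submodule.finiteDimensional_of_le hle

end Partition

/-! ### Approximation by splines -/

lemma sq_integral_le {f : ℝ → ℝ} {a b : ℝ} (hab : a ≤ b) (hf : IntervalIntegrable f volume a b)
    (hf2 : IntervalIntegrable (fun y => f y ^ 2) volume a b) :
    (∫ y in a..b, f y) ^ 2 ≤ (b - a) * ∫ y in a..b, f y ^ 2 := by
  rcases hab.eq_or_lt with rfl | hlt
  · simp
  have hba : 0 < b - a := sub_pos.mpr hlt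
  set I := ∫ y in a..b, f y with hI
  -- Cauchy–Schwarz in disguise: m is the mean of f, and expanding ∫ (f - m)² ≥ 0 gives the bound.
  set m := I / (b - a) with hm
  have h0 : 0 ≤ ∫ y in a..b, (f y - m) ^ 2 :=
    intervalIntegral.integral_nonneg hab fun y _ => sq_nonneg _
  have e : ∀ y, (f y - m) ^ 2 = f y ^ 2 - (2 * m * f y - m ^ 2) := fun y => by ring
  simp only [e] at h0
  rw [intervalIntegral.integral_sub hf2 ((hf.const_mul _).sub intervalIntegrable_const),
    intervalIntegral.integral_sub (hf.const_mul _) intervalIntegrable_const,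
    intervalIntegral.integral_const_mul, intervalIntegral.integral_const, ← hI, smul_eq_mul] at h0
  have hmI : m * (b - a) = I := div_mul_cancel₀ _ hba.ne'
  nlinarith

/-- Error estimate for piecewise constant interpolation of a primitive. -/
lemma integral_sq_sub_le {F f : ℝ → ℝ} {a b : ℝ} (hab : a ≤ b) (hF : Continuous F)
    (hf : IntervalIntegrable f volume a b)
    (hf2 : IntervalIntegrable (fun y => f y ^ 2) volume a b)
    (hFf : ∀ y ∈ Icc a b, F y - F a = ∫ t in a..y, f t) :
    ∫ y in a..b, (F y - F a) ^ 2 ≤ (b - a) ^ 2 * ∫ y in a..b, f y ^ 2 := by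
  have hpt : ∀ y ∈ Icc a b, (F y - F a) ^ 2 ≤ (b - a) * ∫ t in a..b, f t ^ 2 := by
    intro y hy
    have hsub : uIcc a y ⊆ uIcc a b := by
      rw [uIcc_of_le hy.1, uIcc_of_le hab]; exact Icc_subset_Icc_right hy.2
    rw [hFf y hy]
    refine (sq_integral_le hy.1 (hf.mono_set hsub) (hf2.mono_set hsub)).trans ?_
    have h1 : ∫ t in a..y, f t ^ 2 ≤ ∫ t in a..b, f t ^ 2 :=
      intervalIntegral.integral_mono_interval le_rfl hy.1 hy.2
        (Filter.Eventually.of_forall fun t => sq_nonneg _) hf2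
    have h2 : 0 ≤ ∫ t in a..y, f t ^ 2 :=
      intervalIntegral.integral_nonneg hy.1 fun t _ => sq_nonneg _
    exact mul_le_mul (by linarith [hy.2]) h1 h2 (by linarith)
  calc ∫ y in a..b, (F y - F a) ^ 2 ≤ ∫ _y in a..b, (b - a) * ∫ t in a..b, f t ^ 2 :=
        intervalIntegral.integral_mono_on hab
          (((hF.sub continuous_const).pow 2).intervalIntegrable _ _) intervalIntegrable_const hpt
    _ = (b - a) ^ 2 * ∫ y in a..b, f y ^ 2 := by
        rw [intervalIntegral.integral_const, smul_eq_mul]; ring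

lemma prim_sub_prim (g : L2D) (a y : ℝ) : prim g y - prim g a = ∫ t in a..y, extZero g t :=
  intervalIntegral.integral_interval_sub_left (integrable_extZero g).intervalIntegrable
    (integrable_extZero g).intervalIntegrable

lemma dirichletFun_sub_eq_integral (g : L2D) (a y : ℝ) :
    dirichletFun g y - dirichletFun g a = ∫ t in a..y, (prim g t - primTwo g 1) :=
  (intervalIntegral.integral_eq_sub_of_hasDerivAt (fun t _ => hasDerivAt_dirichletFun g t)
    ((continuous_dirichletFun_deriv g).intervalIntegrable _ _)).symm

lemma integrable_extZero_sq (g : L2D) : Integrable fun y => extZero g y ^ 2 :=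
  (memLp_extZero g).integrable_sq

lemma integral_extZero_sq (g : L2D) : ∫ y in (0 : ℝ)..1, extZero g y ^ 2 = ‖g‖ ^ 2 := by
  rw [norm_sq_eq_integral, ← setIntegral_Ioo_eq]
  refine setIntegral_congr_fun measurableSet_Ioo fun y hy => ?_
  simp [extZero, indicator_of_mem hy]

lemma integral_sq_dirichletFun_sub_le (g : L2D) {a b : ℝ} (hab : a ≤ b) :
    ∫ y in a..b, (dirichletFun g y - dirichletFun g a) ^ 2 ≤
      (b - a) ^ 2 * ∫ y in a..b, (prim g y - primTwo g 1) ^ 2 :=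
  integral_sq_sub_le hab (continuous_dirichletFun g)
    ((continuous_dirichletFun_deriv g).intervalIntegrable _ _)
    (((continuous_dirichletFun_deriv g).pow 2).intervalIntegrable _ _)
    fun y _ => dirichletFun_sub_eq_integral g a y

/-- The piecewise constant estimate is used twice: for the function minus its linear part, whose
derivative is `prim g - prim g a`, and then for `prim g`. -/
lemma integral_sq_dirichletFun_taylor_le (g : L2D) {a b : ℝ} (hab : a ≤ b) :
    ∫ y in a..b, (dirichletFun g y - (dirichletFun g a + (prim g a - primTwo g 1) * (y - a))) ^ 2 ≤
      (b - a) ^ 4 * ∫ y in a..b, extZero g y ^ 2 := by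
  have h1 := integral_sq_sub_le (F := prim g) hab (continuous_prim g)
    (integrable_extZero g).intervalIntegrable (integrable_extZero_sq g).intervalIntegrable
    fun y _ => prim_sub_prim g a y
  have hc : Continuous fun y => prim g y - prim g a := (continuous_prim g).sub continuous_const
  have h2 := integral_sq_sub_le
    (F := fun y => dirichletFun g y - (prim g a - primTwo g 1) * (y - a))
    (f := fun y => prim g y - prim g a) hab
    ((continuous_dirichletFun g).sub (by fun_prop)) (hc.intervalIntegrable _ _)
    ((hc.pow 2).intervalIntegrable _ _) (by
      intro y _
      have e := dirichletFun_sub_eq_integral g a y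
      have e2 : ∀ t, prim g t - prim g a = (prim g t - primTwo g 1) - (prim g a - primTwo g 1) :=
        fun t => by ring
      simp only [e2]
      rw [intervalIntegral.integral_sub
        ((continuous_dirichletFun_deriv g).intervalIntegrable _ _) intervalIntegrable_const, ← e,
        intervalIntegral.integral_const, smul_eq_mul]
      ring)
  have e3 : ∀ y, dirichletFun g y - (dirichletFun g a + (prim g a - primTwo g 1) * (y - a)) =
      dirichletFun g y - (prim g a - primTwo g 1) * (y - a) -
        (dirichletFun g a - (prim g a - primTwo g 1) * (a - a)) := fun y => by ring
  simp only [e3]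
  refine h2.trans ?_
  calc (b - a) ^ 2 * ∫ y in a..b, (prim g y - prim g a) ^ 2
      ≤ (b - a) ^ 2 * ((b - a) ^ 2 * ∫ y in a..b, extZero g y ^ 2) :=
        mul_le_mul_of_nonneg_left h1 (sq_nonneg _)
    _ = (b - a) ^ 4 * ∫ y in a..b, extZero g y ^ 2 := by ring

section Spline

variable {N : ℕ} {x : Fin (N + 1) → ℝ} {h : ℝ}

/-- The linear polynomial `α + β (X - a)`. -/
noncomputable def linPoly (a α β : ℝ) : ℝ[X] := C α + C β * (X - C a)

@[simp] lemma eval_linPoly (a α β y : ℝ) : (linPoly a α β).eval y = α + β * (y - a) := by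
  simp [linPoly]

lemma IsPartition.norm_sub_piecewiseLp_sq_le (hx : IsPartition N x h) (b : L2D) {f : ℝ → ℝ}
    (hf : IntervalIntegrable (fun y => f y ^ 2) volume 0 1) (α β : Fin N → ℝ) (n : ℕ)
    (hj : ∀ j : Fin N, ∫ y in (x j.castSucc)..(x j.succ),
      (dirichletFun b y - (α j + β j * (y - x j.castSucc))) ^ 2 ≤
        (x j.succ - x j.castSucc) ^ n * ∫ y in (x j.castSucc)..(x j.succ), f y ^ 2) :
    ‖dirichlet b - piecewiseLp x (fun j => linPoly (x j.castSucc) (α j) (β j))‖ ^ 2 ≤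
      h ^ n * ∫ y in (0 : ℝ)..1, f y ^ 2 := by
  set p : Fin N → ℝ[X] := fun j => linPoly (x j.castSucc) (α j) (β j) with hp
  have hmem : MemLp (fun y => dirichletFun b y - piecewiseFun x p y) 2
      (volume.restrict (Ioo (0 : ℝ) 1)) :=
    (memLp_of_continuous (continuous_dirichletFun b)).sub (memLp_piecewiseFun x p)
  have hint : IntervalIntegrable (fun y => (dirichletFun b y - piecewiseFun x p y) ^ 2)
      volume 0 1 := by
    rw [intervalIntegrable_iff_integrableOn_Ioo_of_le zero_le_one]
    exact hmem.integrable_sq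
  have e : ‖dirichlet b - piecewiseLp x p‖ ^ 2 =
      ∫ y in (0 : ℝ)..1, (dirichletFun b y - piecewiseFun x p y) ^ 2 := by
    rw [norm_sq_eq_integral, ← setIntegral_Ioo_eq]
    refine integral_congr_ae ?_
    filter_upwards [Lp.coeFn_sub (dirichlet b) (piecewiseLp x p), coeFn_piecewiseLp x p,
      coeFn_ofCont (continuous_dirichletFun b)] with y h1 h2 h3
    rw [h1, Pi.sub_apply, h2, dirichlet, h3]
  rw [e, ← hx.sum_integral hint, ← hx.sum_integral hf, Finset.mul_sum]
  refine Finset.sum_le_sum fun j _ => ?_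
  have e2 : ∫ y in (x j.castSucc)..(x j.succ), (dirichletFun b y - piecewiseFun x p y) ^ 2 =
      ∫ y in (x j.castSucc)..(x j.succ),
        (dirichletFun b y - (α j + β j * (y - x j.castSucc))) ^ 2 := by
    refine intervalIntegral.integral_congr_Ioo_of_le (hx.lt j).le fun y hy => ?_
    simp only [hx.piecewiseFun_eq p hy]
    simp only [hp, eval_linPoly]
  rw [e2]
  refine (hj j).trans (mul_le_mul_of_nonneg_right ?_ ?_)
  · exact pow_le_pow_left₀ (sub_nonneg.mpr (hx.lt j).le) (hx.sub_le j) n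
  · exact intervalIntegral.integral_nonneg (hx.lt j).le fun y _ => sq_nonneg _

/-- Integrating a piecewise linear function twice gives a piecewise cubic, and a piecewise quadratic
if the slopes vanish. Regularity and boundary values come from the Dirichlet solution, so nothing
has to be glued by hand. -/
lemma IsPartition.dirichlet_piecewiseLp_mem (hx : IsPartition N x h) {r : ℕ} (hr : 2 ≤ r)
    (α β : Fin N → ℝ) (hβ : 3 ≤ r ∨ ∀ j, β j = 0) :
    dirichlet (piecewiseLp x fun j => linPoly (x j.castSucc) (α j) (β j)) ∈ splineSpace r x := by
  set p : Fin N → ℝ[X] := fun j => linPoly (x j.castSucc) (α j) (β j) with hp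
  set g := piecewiseLp x p with hg
  refine ⟨(isLaplace_dirichlet g).memH, (isLaplace_dirichlet g).memH01, fun j => ?_⟩
  set a := x j.castSucc with ha
  have hprim : ∀ y ∈ Icc a (x j.succ), prim g y = prim g a + α j * (y - a) + β j / 2 * (y - a) ^ 2 := by
    intro y hy
    have hae : ∫ t in a..y, extZero g t = ∫ t in a..y, (α j + β j * (t - a)) := by
      rw [intervalIntegral.integral_of_le hy.1, intervalIntegral.integral_of_le hy.1,
        integral_Ioc_eq_integral_Ioo, integral_Ioc_eq_integral_Ioo]
      refine integral_congr_ae ?_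
      have hsub : Ioo a y ⊆ Ioo a (x j.succ) := Ioo_subset_Ioo_right hy.2
      have hr : volume.restrict (Ioo a y) ≤ volume.restrict (Ioo (0 : ℝ) 1) :=
        Measure.restrict_mono (hsub.trans (hx.Ioo_subset j)) le_rfl
      filter_upwards [ae_mono hr (coeFn_piecewiseLp x p), ae_restrict_mem measurableSet_Ioo]
        with t h1 h2
      rw [extZero, indicator_of_mem (hx.Ioo_subset j (hsub h2)), hg, h1,
        hx.piecewiseFun_eq p (hsub h2), hp, eval_linPoly]
    have hd : ∀ t ∈ uIcc a y, HasDerivAt (fun t => α j * (t - a) + β j / 2 * (t - a) ^ 2)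
        (α j + β j * (t - a)) t := by
      intro t _
      have h1 : HasDerivAt (fun t => t - a) 1 t := (hasDerivAt_id t).sub_const a
      refine ((h1.const_mul (α j)).add ((h1.pow 2).const_mul (β j / 2))).congr_deriv ?_
      simp; ring
    have := prim_sub_prim g a y
    rw [hae, intervalIntegral.integral_eq_sub_of_hasDerivAt hd
      (Continuous.intervalIntegrable (by fun_prop) _ _)] at this
    linear_combination this
  have htwo : ∀ y ∈ Icc a (x j.succ), primTwo g y = primTwo g a + prim g a * (y - a) +
      α j / 2 * (y - a) ^ 2 + β j / 6 * (y - a) ^ 3 := by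
    intro y hy
    have h1 : primTwo g y - primTwo g a = ∫ t in a..y, prim g t :=
      (intervalIntegral.integral_eq_sub_of_hasDerivAt (fun t _ => hasDerivAt_primTwo g t)
        ((continuous_prim g).intervalIntegrable _ _)).symm
    have h2 : ∫ t in a..y, prim g t =
        ∫ t in a..y, (prim g a + α j * (t - a) + β j / 2 * (t - a) ^ 2) := by
      refine intervalIntegral.integral_congr fun t ht => ?_
      rw [uIcc_of_le hy.1] at ht
      exact hprim t ⟨ht.1, ht.2.trans hy.2⟩
    have hd : ∀ t ∈ uIcc a y, HasDerivAt
        (fun t => prim g a * (t - a) + α j / 2 * (t - a) ^ 2 + β j / 6 * (t - a) ^ 3)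
        (prim g a + α j * (t - a) + β j / 2 * (t - a) ^ 2) t := by
      intro t _
      have h1 : HasDerivAt (fun t => t - a) 1 t := (hasDerivAt_id t).sub_const a
      refine (((h1.const_mul (prim g a)).add ((h1.pow 2).const_mul (α j / 2))).add
        ((h1.pow 3).const_mul (β j / 6))).congr_deriv ?_
      simp; ring
    rw [h2, intervalIntegral.integral_eq_sub_of_hasDerivAt hd
      (Continuous.intervalIntegrable (by fun_prop) _ _)] at h1
    linear_combination h1
  refine ⟨C (primTwo g a) + C (prim g a) * (X - C a) + C (α j / 2) * (X - C a) ^ 2 +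
    C (β j / 6) * (X - C a) ^ 3 - C (primTwo g 1) * X, ?_, ?_⟩
  · rcases hβ with h3 | h0
    · refine le_trans ?_ h3
      compute_degree
    · refine le_trans ?_ hr
      rw [h0 j, zero_div, C_0, zero_mul, add_zero]
      compute_degree
  · filter_upwards [coeFn_ofCont (continuous_dirichletFun g)] with y hy hyj
    rw [dirichlet, hy, dirichletFun, htwo y (Ioo_subset_Icc_self hyj)]
    simp

lemma IsLaplace.weakDeriv_sub {u g χ : L2D} (hu : IsLaplace u g)
    (hχ : IsLaplace χ (weakDeriv 2 χ)) : weakDeriv 2 (u - χ) = g - weakDeriv 2 χ :=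
  (hu.sub hχ).weakDeriv_two

lemma isLaplace_of_mem_splineSpace {r : ℕ} {χ : L2D} (hχ : χ ∈ splineSpace r x) :
    IsLaplace χ (weakDeriv 2 χ) :=
  isLaplace_weakDeriv hχ.1 hχ.2.1.2

/-- Approximation by splines on an arbitrary partition. -/
lemma IsPartition.exists_spline_approx (hx : IsPartition N x h) {r : ℕ} (hr : r = 2 ∨ r = 3)
    {v a b : L2D} (hva : IsLaplace v a) (hab : IsLaplace a b) :
    ∃ χ ∈ splineSpace r x, ‖a - weakDeriv 2 χ‖ ≤ h ^ (r - 1) * hdotNorm ((r : ℝ) + 1) v := by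
  have ha : a = dirichlet b := hab.eq_dirichlet
  have hh := hx.pos
  rcases hr with rfl | rfl
  -- For r = 2 the second derivative a is replaced by its left-endpoint values.
  · refine ⟨_, hx.dirichlet_piecewiseLp_mem le_rfl
      (fun j => dirichletFun b (x j.castSucc)) (fun _ => 0) (Or.inr fun _ => rfl), ?_⟩
    rw [(isLaplace_dirichlet _).weakDeriv_two, ha]
    have hc : Continuous fun y => (prim b y - primTwo b 1) ^ 2 :=
      (continuous_dirichletFun_deriv b).pow 2
    have key := hx.norm_sub_piecewiseLp_sq_le b (hc.intervalIntegrable 0 1)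
      (fun j => dirichletFun b (x j.castSucc)) (fun _ => 0) 2 fun j => by
        simpa using integral_sq_dirichletFun_sub_le b (hx.lt j).le
    have e : ∫ y in (0 : ℝ)..1, (prim b y - primTwo b 1) ^ 2 = hdotNorm 3 v ^ 2 := by
      rw [hva.hdotNorm_three_sq hab, ha, ← norm_dirichletDeriv_sq, norm_sq_eq_integral,
        ← setIntegral_Ioo_eq]
      refine integral_congr_ae ?_
      filter_upwards [coeFn_ofCont (continuous_dirichletFun_deriv b)] with y hy
      rw [dirichletDeriv, hy]
    rw [e, ← mul_pow] at key
    have := le_of_sq_le_sq key (mul_nonneg hh.le (hdotNorm_nonneg _ _))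
    norm_num
    exact this
  -- For r = 3 it is replaced by its first-order Taylor polynomial at the left endpoint.
  · refine ⟨_, hx.dirichlet_piecewiseLp_mem (by norm_num)
      (fun j => dirichletFun b (x j.castSucc)) (fun j => prim b (x j.castSucc) - primTwo b 1)
      (Or.inl le_rfl), ?_⟩
    rw [(isLaplace_dirichlet _).weakDeriv_two, ha]
    have key := hx.norm_sub_piecewiseLp_sq_le b (integrable_extZero_sq b).intervalIntegrable
      (fun j => dirichletFun b (x j.castSucc)) (fun j => prim b (x j.castSucc) - primTwo b 1) 4
      fun j => integral_sq_dirichletFun_taylor_le b (hx.lt j).le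
    rw [integral_extZero_sq, ← (hva.memHdot_four hab).2,
      show h ^ 4 * hdotNorm 4 v ^ 2 = (h ^ 2 * hdotNorm 4 v) ^ 2 by ring] at key
    have := le_of_sq_le_sq key (mul_nonneg (by positivity) (hdotNorm_nonneg _ _))
    norm_num
    exact this

lemma IsFiniteElementSpace.le {K : ℝ} {r : ℕ} {V : Submodule ℝ L2D}
    (hV : IsFiniteElementSpace K r x h V) : V ≤ splineSpace r x := by
  rcases hV with rfl | hV
  · exact le_rfl
  · exact hV.1

/-- Approximation by finite element functions. -/
lemma IsFiniteElementSpace.exists_approx {K : ℝ} {r : ℕ} {V : Submodule ℝ L2D}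
    (hV : IsFiniteElementSpace K r x h V) (hx : IsPartition N x h) (hr : r = 2 ∨ r = 3)
    {v a b : L2D} (hva : IsLaplace v a) (hab : IsLaplace a b) :
    ∃ χ ∈ V, ‖a - weakDeriv 2 χ‖ ≤
      (3 * |K| + 1) * h ^ (r - 1) * hdotNorm ((r : ℝ) + 1) v := by
  have hh := hx.pos
  have hnn : 0 ≤ h ^ (r - 1) * hdotNorm ((r : ℝ) + 1) v :=
    mul_nonneg (by positivity) (hdotNorm_nonneg _ _)
  rcases hV with rfl | ⟨hle, hap⟩
  · obtain ⟨χ, hχ, hb⟩ := hx.exists_spline_approx hr hva hab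
    refine ⟨χ, hχ, hb.trans ?_⟩
    nlinarith [abs_nonneg K]
  · have hr4 : r + 1 ≤ 4 := by omega
    have hr4' : (r : ℝ) + 1 ≤ 4 := by exact_mod_cast hr4
    have hr2 : (2 : ℝ) ≤ (r : ℝ) + 1 := by
      have : 2 ≤ r + 1 := by omega
      exact_mod_cast this
    have hm : MemHdot ((r : ℝ) + 1) v := (hva.memHdot_four hab).1.mono hr4'
    obtain ⟨hmem, hsob⟩ := hva.sobolevNorm_le hab hr4
    -- The infimum need not be attained, so a strict inequality is needed to extract χ; the extra 1
    -- in the constant supplies it unless the bound is zero, and then a = 0 and χ = 0 works.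
    rcases hnn.eq_or_lt with h0 | hpos
    · have hz : hdotNorm ((r : ℝ) + 1) v = 0 :=
        (mul_eq_zero.mp h0.symm).resolve_left (by positivity)
      have ha : ‖a‖ ≤ 0 := by
        rw [← hva.memHdot_two.2, ← hz]
        exact hm.hdotNorm_mono hr2
      refine ⟨0, V.zero_mem, ?_⟩
      rw [(hasWeakDeriv_zero 2).weakDeriv_eq, sub_zero, hz, mul_zero]
      exact ha
    · have hinf := hap r (Or.inr rfl) v hmem hva.memH01
      have hlt : ⨅ χ : V, sobolevNorm 2 (v - (χ : L2D)) <
          (3 * |K| + 1) * h ^ (r - 1) * hdotNorm ((r : ℝ) + 1) v := by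
        refine hinf.trans_lt ?_
        push_cast at hsob
        have hs0 : 0 ≤ sobolevNorm (r + 1) v := Real.sqrt_nonneg _
        have hp : 0 < h ^ (r - 1) := by positivity
        calc K * h ^ (r - 1) * sobolevNorm (r + 1) v
            ≤ |K| * h ^ (r - 1) * (3 * hdotNorm ((r : ℝ) + 1) v) := by
              refine mul_le_mul (mul_le_mul_of_nonneg_right (le_abs_self K) hp.le) hsob hs0 ?_
              positivity
          _ < (3 * |K| + 1) * h ^ (r - 1) * hdotNorm ((r : ℝ) + 1) v := by linarith
      obtain ⟨χ, hχ⟩ := exists_lt_of_ciInf_lt hlt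
      refine ⟨χ, χ.2, ?_⟩
      rw [← hva.weakDeriv_sub (isLaplace_of_mem_splineSpace (hle χ.2))]
      exact (norm_weakDeriv_le_sobolevNorm le_rfl _).trans hχ.le

end Spline

/-! ### A discrete Gronwall inequality -/

/-- With q = 1 - 2κτ, the quantity q^n (E n + partial sum of a) is bounded by the data by induction,
and q^M is then traded for an exponential of the total time. -/
lemma sum_le_of_discrete_gronwall {κ τ : ℝ} (hκ : 0 ≤ κ) (hτ : 0 ≤ τ) (hκτ : κ * τ < 1 / 4)
    {E a r : ℕ → ℝ} (hE : ∀ m, 0 ≤ E m) (ha : ∀ m, 0 ≤ a m) (hr : ∀ m, 0 ≤ r m) {M : ℕ}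
    (hstep : ∀ m ∈ Finset.Icc 1 M,
      (1 - 2 * (κ * τ)) * E m + τ * a m ≤ E (m - 1) + τ * r m) :
    ∑ m ∈ Finset.Icc 1 M, τ * a m ≤
      Real.exp (4 * κ * (τ * M)) * (E 0 + ∑ m ∈ Finset.Icc 1 M, τ * r m) := by
  have hκτ0 : 0 ≤ κ * τ := mul_nonneg hκ hτ
  set q := 1 - 2 * (κ * τ) with hq
  have hq0 : 0 < q := by linarith
  have hq1 : q ≤ 1 := by linarith
  have key : ∀ n ≤ M, q ^ n * (E n + ∑ m ∈ Finset.Icc 1 n, τ * a m) ≤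
      E 0 + ∑ m ∈ Finset.Icc 1 n, τ * r m := by
    intro n
    induction n with
    | zero => intro _; simp
    | succ n ih =>
      intro hn
      rw [Finset.sum_Icc_succ_top (by omega), Finset.sum_Icc_succ_top (by omega)]
      have h1 := hstep (n + 1) (Finset.mem_Icc.mpr ⟨by omega, hn⟩)
      rw [Nat.add_sub_cancel] at h1
      have h2 := ih (by omega)
      set S := ∑ m ∈ Finset.Icc 1 n, τ * a m
      have hS : 0 ≤ S := Finset.sum_nonneg fun m _ => mul_nonneg hτ (ha m)
      have hqn : 0 ≤ q ^ n := by positivity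
      have hqn1 : q ^ n ≤ 1 := pow_le_one₀ hq0.le hq1
      have hta : 0 ≤ τ * a (n + 1) := mul_nonneg hτ (ha _)
      have htr : 0 ≤ τ * r (n + 1) := mul_nonneg hτ (hr _)
      calc q ^ (n + 1) * (E (n + 1) + (S + τ * a (n + 1)))
          = q ^ n * (q * E (n + 1) + q * (S + τ * a (n + 1))) := by ring
        _ ≤ q ^ n * (q * E (n + 1) + (S + τ * a (n + 1))) := by
            gcongr
            exact mul_le_of_le_one_left (by positivity) hq1
        _ ≤ q ^ n * (E n + S + τ * r (n + 1)) :=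
            mul_le_mul_of_nonneg_left (by linarith) hqn
        _ = q ^ n * (E n + S) + q ^ n * (τ * r (n + 1)) := by ring
        _ ≤ _ := by
            have := mul_le_of_le_one_left htr hqn1
            linarith
  have hM := key M le_rfl
  set S := ∑ m ∈ Finset.Icc 1 M, τ * a m
  set R := E 0 + ∑ m ∈ Finset.Icc 1 M, τ * r m
  have hS : 0 ≤ S := Finset.sum_nonneg fun m _ => mul_nonneg hτ (ha m)
  -- For t = κτ one has (1 - 2t)(1 + 4t) ≥ 1 exactly when 0 ≤ t ≤ 1/4.
  have hqe : 1 ≤ q * Real.exp (4 * (κ * τ)) := by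
    have h1 := Real.add_one_le_exp (4 * (κ * τ))
    have h2 : q * (4 * (κ * τ) + 1) ≤ q * Real.exp (4 * (κ * τ)) :=
      mul_le_mul_of_nonneg_left h1 hq0.le
    nlinarith
  have hqeM : 1 ≤ q ^ M * Real.exp (4 * κ * (τ * M)) := by
    have : Real.exp (4 * κ * (τ * M)) = Real.exp (4 * (κ * τ)) ^ M := by
      rw [← Real.exp_nat_mul]; ring_nf
    rw [this, ← mul_pow]
    exact one_le_pow₀ hqe
  calc S ≤ (q ^ M * Real.exp (4 * κ * (τ * M))) * S := le_mul_of_one_le_left hS hqeM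
    _ ≤ (q ^ M * Real.exp (4 * κ * (τ * M))) * (E M + S) := by
        gcongr
        linarith [hE M]
    _ = Real.exp (4 * κ * (τ * M)) * (q ^ M * (E M + S)) := by ring
    _ ≤ Real.exp (4 * κ * (τ * M)) * R := by gcongr

/-! ### The bilinear form -/

/-- The shifted bilinear form `(∂²u, ∂²v) + μ (∂²u, v) + μ² (u, v)`, with `g = ∂²u`, `k = ∂²v`. -/
noncomputable def shiftedForm (μ : ℝ) (u g v k : L2D) : ℝ :=
  inner ℝ g k + μ * inner ℝ g v + μ ^ 2 * inner ℝ u v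

/-- Young's inequality splits μ (g, u) into halves of ‖g‖² and μ² ‖u‖², so the shift μ² is enough
whatever the size of μ. -/
lemma shiftedForm_coercive {μ : ℝ} (hμ : 0 ≤ μ) (u g : L2D) :
    1 / 2 * ‖g‖ ^ 2 + 1 / 2 * (μ * ‖u‖) ^ 2 ≤ shiftedForm μ u g u g := by
  rw [shiftedForm, real_inner_self_eq_norm_sq, real_inner_self_eq_norm_sq]
  have h1 := (abs_le.mp (abs_real_inner_le_norm g u)).1
  have h2 := mul_le_mul_of_nonneg_left h1 hμ
  nlinarith [sq_nonneg (‖g‖ - μ * ‖u‖)]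

lemma shiftedForm_le {μ : ℝ} (hμ : 0 ≤ μ) {u g v k : L2D} (hu : IsLaplace u g)
    (hv : IsLaplace v k) : shiftedForm μ u g v k ≤ (1 + μ + μ ^ 2) * (‖g‖ * ‖k‖) := by
  have h1 := real_inner_le_norm g k
  have h2 : inner ℝ g v ≤ ‖g‖ * ‖k‖ := (real_inner_le_norm g v).trans
    (mul_le_mul_of_nonneg_left hv.norm_le (norm_nonneg _))
  have h3 : inner ℝ u v ≤ ‖g‖ * ‖k‖ := (real_inner_le_norm u v).trans
    (mul_le_mul hu.norm_le hv.norm_le (norm_nonneg _) (norm_nonneg _))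
  have h4 := mul_le_mul_of_nonneg_left h2 hμ
  have h5 := mul_le_mul_of_nonneg_left h3 (sq_nonneg μ)
  rw [shiftedForm]
  linarith

lemma shiftedForm_sub_right (μ : ℝ) (u g v k v' k' : L2D) :
    shiftedForm μ u g (v - v') (k - k') = shiftedForm μ u g v k - shiftedForm μ u g v' k' := by
  simp only [shiftedForm, inner_sub_right]; ring

lemma shiftedForm_sub_left (μ : ℝ) (u g u' g' v k : L2D) :
    shiftedForm μ (u - u') (g - g') v k = shiftedForm μ u g v k - shiftedForm μ u' g' v k := by
  simp only [shiftedForm, inner_sub_left]; ring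

lemma shiftedForm_comm {μ : ℝ} {u g v k : L2D} (hu : IsLaplace u g) (hv : IsLaplace v k) :
    shiftedForm μ u g v k = shiftedForm μ v k u g := by
  simp only [shiftedForm]
  rw [real_inner_comm k g, real_inner_comm v u, hu.inner_comm hv, real_inner_comm k u]

lemma IsLaplace.shiftedForm_eq {μ : ℝ} {v a b χ d : L2D} (hab : IsLaplace a b) (hχ : IsLaplace χ d) :
    shiftedForm μ v a χ d = inner ℝ (b + μ • a + μ ^ 2 • v) χ := by
  rw [shiftedForm, ← hab.inner_comm hχ, inner_add_left, inner_add_left, real_inner_smul_left,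
    real_inner_smul_left]

/-- The difference of the two sides is ½ (λ² - μ)² + ½ μ². -/
lemma half_lam_pow_four_le (μ : ℝ) (k : ℕ) :
    1 / 2 * lam k ^ 4 ≤ lam k ^ 4 - μ * lam k ^ 2 + μ ^ 2 := by
  nlinarith [sq_nonneg (lam k ^ 2 - μ), sq_nonneg μ]

/-- Solvability and regularity for the shifted problem `∂⁴z + μ ∂²z + μ² z = f`. -/
lemma exists_shifted_solution (μ : ℝ) (f : L2D) :
    ∃ z a b : L2D, IsLaplace z a ∧ IsLaplace a b ∧ b + μ • a + μ ^ 2 • z = f ∧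
      ‖b‖ ≤ 2 * ‖f‖ := by
  set σ : ℕ → ℝ := fun k => lam k ^ 4 - μ * lam k ^ 2 + μ ^ 2 with hσ
  have hl : ∀ k, 0 < lam k ^ 4 := fun k => pow_pos (lam_pos k) 4
  have hσ0 : ∀ k, 0 < σ k := fun k => by
    have := half_lam_pow_four_le μ k
    have := hl k
    simp only [hσ]; linarith
  have hle : ∀ k, (lam k ^ 4 / σ k * sineCoeff k f) ^ 2 ≤ 4 * sineCoeff k f ^ 2 := by
    intro k
    have h1 : lam k ^ 4 / σ k ≤ 2 := by
      rw [div_le_iff₀ (hσ0 k)]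
      have := half_lam_pow_four_le μ k
      simp only [hσ]; linarith
    have h0 : 0 ≤ lam k ^ 4 / σ k := (div_pos (hl k) (hσ0 k)).le
    rw [mul_pow]
    refine mul_le_mul_of_nonneg_right ?_ (sq_nonneg _)
    nlinarith
  have hs := (hasSum_sineCoeff_sq f).mul_left 4
  obtain ⟨b, hb⟩ := exists_sineCoeff_eq (c := fun k => lam k ^ 4 / σ k * sineCoeff k f)
    (Summable.of_nonneg_of_le (fun k => sq_nonneg _) hle hs.summable)
  refine ⟨dirichlet (dirichlet b), dirichlet b, b, isLaplace_dirichlet _, isLaplace_dirichlet _,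
    ext_sineCoeff fun k => ?_, ?_⟩
  · have e1 := isLaplace_dirichlet b k
    have e2 := isLaplace_dirichlet (dirichlet b) k
    set z := sineCoeff k (dirichlet (dirichlet b))
    have e3 : lam k ^ 4 * z = lam k ^ 4 * (sineCoeff k f / σ k) := by
      have e4 : sineCoeff k b = lam k ^ 4 * z := by rw [e1, e2]; ring
      rw [← e4, hb k]; ring
    have e5 : z = sineCoeff k f / σ k := mul_left_cancel₀ (hl k).ne' e3
    have e6 : z * σ k = sineCoeff k f := by rw [e5, div_mul_cancel₀ _ (hσ0 k).ne']
    simp only [sineCoeff_add, sineCoeff_smul]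
    rw [e1, e2, ← e6]
    simp only [hσ, z]
    ring
  · refine le_of_sq_le_sq ?_ (by positivity)
    have hb2 := hasSum_sineCoeff_sq b
    simp only [hb] at hb2
    refine (hasSum_le hle hb2 hs).trans (le_of_eq (by ring))

/-! ### Galerkin approximations -/

/-- A positive definite bilinear form on a finite-dimensional subspace has a solution operator. -/
lemma exists_galerkin_solution {V : Submodule ℝ L2D} [FiniteDimensional ℝ V]
    (b : V →ₗ[ℝ] V →ₗ[ℝ] ℝ) (hb : ∀ u, u ≠ 0 → 0 < b u u) :
    ∃ P : L2D →ₗ[ℝ] V, ∀ (f : L2D) (χ : V), b (P f) χ = inner ℝ f (χ : L2D) := by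
  have hinj : Function.Injective b := by
    refine (injective_iff_map_eq_zero b).mpr fun u hu => ?_
    by_contra hne
    have := hb u hne
    rw [hu] at this
    simp at this
  -- Positivity gives injectivity, and in finite dimension equality of dimensions turns it into an
  -- isomorphism onto the dual.
  let B : V ≃ₗ[ℝ] Module.Dual ℝ V :=
    LinearEquiv.ofInjectiveOfFinrankEq b hinj (Subspace.dual_finrank_eq).symm
  let L : L2D →ₗ[ℝ] Module.Dual ℝ V :=
    (LinearMap.lcomp ℝ ℝ V.subtype).comp (innerₗ L2D)
  refine ⟨B.symm.toLinearMap.comp L, fun f χ => ?_⟩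
  have h1 : B (B.symm (L f)) = L f := B.apply_symm_apply _
  have h2 : b (B.symm (L f)) = L f := h1
  rw [LinearMap.comp_apply, LinearEquiv.coe_coe, h2]
  rfl

section Galerkin

variable {V : Submodule ℝ L2D}

/-- The bilinear form `α (u, χ) + β ((∂²u, ∂²χ) + μ (∂²u, χ))` on a finite element space. -/
noncomputable def galerkinForm (hV : ∀ u ∈ V, IsLaplace u (weakDeriv 2 u)) (α β μ : ℝ) : V →ₗ[ℝ] V →ₗ[ℝ] ℝ :=
  LinearMap.mk₂ ℝ
    (fun u χ => α * inner ℝ (u : L2D) (χ : L2D) + β * (inner ℝ (weakDeriv 2 (u : L2D))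
      (weakDeriv 2 (χ : L2D)) + μ * inner ℝ (weakDeriv 2 (u : L2D)) (χ : L2D)))
    (fun u v χ => by
      rw [Submodule.coe_add, ((hV u u.2).add (hV v v.2)).weakDeriv_two]
      simp only [inner_add_left]; ring)
    (fun c u χ => by
      rw [Submodule.coe_smul, ((hV u u.2).smul c).weakDeriv_two]
      simp only [real_inner_smul_left, smul_eq_mul]; ring)
    (fun u v χ => by
      rw [Submodule.coe_add, ((hV v v.2).add (hV χ χ.2)).weakDeriv_two]
      simp only [inner_add_right]; ring)
    (fun c u χ => by
      rw [Submodule.coe_smul, ((hV χ χ.2).smul c).weakDeriv_two]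
      simp only [real_inner_smul_right, smul_eq_mul]; ring)

end Galerkin

section Galerkin

variable {V : Submodule ℝ L2D}

lemma galerkinForm_apply (hV : ∀ u ∈ V, IsLaplace u (weakDeriv 2 u)) (α β μ : ℝ) (u χ : V) :
    galerkinForm hV α β μ u χ = α * inner ℝ (u : L2D) (χ : L2D) +
      β * (inner ℝ (weakDeriv 2 (u : L2D)) (weakDeriv 2 (χ : L2D)) +
        μ * inner ℝ (weakDeriv 2 (u : L2D)) (χ : L2D)) := rfl

/-- `T` is the discrete solution operator of the shifted problem. -/
def IsDiscreteSolution (μ : ℝ) (V : Submodule ℝ L2D) (T : L2D →ₗ[ℝ] V) : Prop :=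
  ∀ (f : L2D) (χ : V), shiftedForm μ (T f : L2D) (weakDeriv 2 (T f : L2D)) (χ : L2D)
    (weakDeriv 2 (χ : L2D)) = inner ℝ f (χ : L2D)

lemma exists_isDiscreteSolution [FiniteDimensional ℝ V]
    (hV : ∀ u ∈ V, IsLaplace u (weakDeriv 2 u)) {μ : ℝ} (hμ : 0 ≤ μ) :
    ∃ T : L2D →ₗ[ℝ] V, IsDiscreteSolution μ V T := by
  have e : ∀ u χ : V, galerkinForm hV (μ ^ 2) 1 μ u χ = shiftedForm μ (u : L2D)
      (weakDeriv 2 (u : L2D)) (χ : L2D) (weakDeriv 2 (χ : L2D)) := fun u χ => by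
    rw [galerkinForm_apply, shiftedForm]; ring
  obtain ⟨T, hT⟩ := exists_galerkin_solution (galerkinForm hV (μ ^ 2) 1 μ) (by
    intro u hu
    rw [e]
    have h1 := shiftedForm_coercive hμ (u : L2D) (weakDeriv 2 (u : L2D))
    have h2 := (hV u u.2).norm_le
    have h3 : 0 < ‖(u : L2D)‖ := norm_pos_iff.mpr (by simpa using hu)
    have h4 : 0 < ‖weakDeriv 2 (u : L2D)‖ := h3.trans_le h2
    nlinarith [sq_nonneg (μ * ‖(u : L2D)‖)])
  exact ⟨T, fun f χ => by rw [← e]; exact hT f χ⟩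

lemma exists_isL2Projection [FiniteDimensional ℝ V] (f : L2D) : ∃ p, IsL2Projection V f p := by
  refine ⟨V.starProjection f, Submodule.starProjection_apply_mem _ _, fun χ hχ => ?_⟩
  have := Submodule.starProjection_inner_eq_zero f χ hχ
  rw [inner_sub_left] at this
  linarith

/-- Existence for one step of the fully-discrete method. -/
lemma exists_discrete_step [FiniteDimensional ℝ V]
    (hV : ∀ u ∈ V, IsLaplace u (weakDeriv 2 u)) {μ τ : ℝ} (hτ : 0 < τ) (hμτ : μ ^ 2 * τ < 1 / 4)
    {f : L2D} (hf : f ∈ V) :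
    ∃ u ∈ V, ∃ z, IsDiscreteElliptic μ V u z ∧ u - f + τ • z = 0 := by
  obtain ⟨P, hP⟩ := exists_galerkin_solution (galerkinForm hV 1 τ μ) (by
    intro u hu
    rw [galerkinForm_apply, real_inner_self_eq_norm_sq, real_inner_self_eq_norm_sq]
    have h3 : 0 < ‖(u : L2D)‖ := norm_pos_iff.mpr (by simpa using hu)
    set g := weakDeriv 2 (u : L2D)
    set U := ‖(u : L2D)‖
    have h1 : -(|μ| * (‖g‖ * U)) ≤ μ * inner ℝ g (u : L2D) := by
      have := abs_real_inner_le_norm g (u : L2D)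
      have h2 := mul_le_mul_of_nonneg_left this (abs_nonneg μ)
      rw [← abs_mul] at h2
      linarith [(abs_le.mp h2).1]
    -- After multiplication by τ the negative part is at most U²/16, which the L² term of the form
    -- dominates.
    have h4 : -(μ ^ 2 / 4 * U ^ 2) ≤ ‖g‖ ^ 2 + μ * inner ℝ g (u : L2D) := by
      nlinarith [sq_nonneg (‖g‖ - |μ| / 2 * U), sq_abs μ]
    have h5 := mul_le_mul_of_nonneg_left h4 hτ.le
    nlinarith [pow_pos h3 2])
  set u := P f with hu
  refine ⟨u, u.2, τ⁻¹ • (f - u), ⟨V.smul_mem _ (V.sub_mem hf u.2), fun χ hχ => ?_⟩, ?_⟩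
  · have h := hP f ⟨χ, hχ⟩
    rw [galerkinForm_apply, ← hu] at h
    rw [real_inner_smul_left, inner_sub_left, ← h]
    field_simp
    ring
  · rw [smul_smul, mul_inv_cancel₀ hτ.ne', one_smul]
    abel

lemma exists_isFullyDiscrete [FiniteDimensional ℝ V]
    (hV : ∀ u ∈ V, IsLaplace u (weakDeriv 2 u)) {μ τ : ℝ} (hτ : 0 < τ) (hμτ : μ ^ 2 * τ < 1 / 4)
    (M : ℕ) (w₀ : L2D) : ∃ Wh, IsFullyDiscrete μ τ M V w₀ Wh := by
  obtain ⟨p, hp⟩ := exists_isL2Projection (V := V) w₀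
  choose S hS using fun f : V => exists_discrete_step hV hτ hμτ f.2
  -- The recursion runs inside V, since each step needs its predecessor to be a member of V.
  let Q : ℕ → V := fun n => Nat.rec ⟨p, hp.1⟩ (fun _ f => ⟨S f, (hS f).1⟩) n
  let Wh : ℕ → L2D := fun n => (Q n).1
  refine ⟨Wh, hp, fun m hm => ⟨(Q m).2, ?_⟩⟩
  obtain ⟨n, rfl⟩ : ∃ n, m = n + 1 := ⟨m - 1, by have := (Finset.mem_Icc.mp hm).1; omega⟩
  exact (hS (Q n)).2

lemma IsFullyDiscrete.sub (hV : ∀ u ∈ V, IsLaplace u (weakDeriv 2 u)) {μ τ : ℝ} {M : ℕ}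
    {w v : L2D} {Wh Vh : ℕ → L2D} (hW : IsFullyDiscrete μ τ M V w Wh)
    (hv : IsFullyDiscrete μ τ M V v Vh) :
    IsFullyDiscrete μ τ M V (w - v) fun m => Wh m - Vh m := by
  refine ⟨⟨V.sub_mem hW.1.1 hv.1.1, fun χ hχ => ?_⟩, fun m hm => ?_⟩
  · rw [inner_sub_left, inner_sub_left, hW.1.2 χ hχ, hv.1.2 χ hχ]
  · obtain ⟨h1, z, hz, hz'⟩ := hW.2 m hm
    obtain ⟨h2, y, hy, hy'⟩ := hv.2 m hm
    refine ⟨V.sub_mem h1 h2, z - y, ⟨V.sub_mem hz.1 hy.1, fun χ hχ => ?_⟩, ?_⟩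
    · rw [inner_sub_left, hz.2 χ hχ, hy.2 χ hχ, ((hV _ h1).sub (hV _ h2)).weakDeriv_two]
      simp only [inner_sub_left]
      ring
    · change Wh m - Vh m - (Wh (m - 1) - Vh (m - 1)) + τ • (z - y) = 0
      rw [smul_sub, ← sub_zero (0 : L2D)]
      nth_rw 1 [← hz']
      rw [← hy']
      abel

/-! ### The discrete solution operator and its energy -/

variable {μ : ℝ} {T : L2D →ₗ[ℝ] V}

lemma IsDiscreteSolution.inner_comm (hT : IsDiscreteSolution μ V T)
    (hV : ∀ u ∈ V, IsLaplace u (weakDeriv 2 u)) (f g : L2D) :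
    inner ℝ f (T g : L2D) = inner ℝ g (T f : L2D) := by
  rw [← hT f (T g), ← hT g (T f), shiftedForm_comm (hV _ (T f).2) (hV _ (T g).2)]

lemma IsDiscreteSolution.half_norm_sq_le (hT : IsDiscreteSolution μ V T) (hμ : 0 ≤ μ) (f : L2D) :
    1 / 2 * ‖weakDeriv 2 (T f : L2D)‖ ^ 2 ≤ inner ℝ f (T f : L2D) := by
  rw [← hT f (T f)]
  have := shiftedForm_coercive hμ (T f : L2D) (weakDeriv 2 (T f : L2D))
  nlinarith [sq_nonneg (μ * ‖(T f : L2D)‖)]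

lemma IsDiscreteSolution.inner_nonneg (hT : IsDiscreteSolution μ V T) (hμ : 0 ≤ μ) (f : L2D) :
    0 ≤ inner ℝ f (T f : L2D) :=
  le_trans (by positivity) (hT.half_norm_sq_le hμ f)

/-- Inverting the Dirichlet Laplacian divides each coefficient by -λ_k². This form of the norm lets
it enter through Green's formula. -/
lemma hdotNorm_neg_two (f : L2D) : hdotNorm (-2) f = ‖dirichlet f‖ := by
  refine (sq_eq_sq₀ (hdotNorm_nonneg _ _) (norm_nonneg _)).mp
    (memHdot_of_hasSum (s := -2) (v := f) ?_).2
  convert hasSum_sineCoeff_sq (dirichlet f) using 2 with k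
  have h := lam_rpow_natCast 2 k
  push_cast at h
  have hl : lam k ≠ 0 := (lam_pos k).ne'
  rw [mul_neg, Real.rpow_neg (lam_pos k).le, h, isLaplace_dirichlet f k]
  field_simp

/-- Writing f as a Laplacian moves two derivatives onto T f, and the factor ‖∂²(T f)‖ is absorbed by
coercivity. Only the Ḣ⁻² norm of f is left. -/
lemma IsDiscreteSolution.inner_le (hT : IsDiscreteSolution μ V T)
    (hV : ∀ u ∈ V, IsLaplace u (weakDeriv 2 u)) (hμ : 0 ≤ μ) (f : L2D) :
    inner ℝ f (T f : L2D) ≤ 2 * hdotNorm (-2) f ^ 2 := by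
  have h1 := hT.half_norm_sq_le hμ f
  have h2 : inner ℝ f (T f : L2D) ≤ ‖dirichlet f‖ * ‖weakDeriv 2 (T f : L2D)‖ := by
    rw [(isLaplace_dirichlet f).inner_comm (hV _ (T f).2)]
    exact real_inner_le_norm _ _
  rw [hdotNorm_neg_two]
  nlinarith [sq_nonneg (2 * ‖dirichlet f‖ - ‖weakDeriv 2 (T f : L2D)‖)]

/-- The basic energy estimate for the backward Euler method in the norm defined by `T`. -/
lemma IsDiscreteSolution.energy_estimate (hT : IsDiscreteSolution μ V T)
    (hV : ∀ u ∈ V, IsLaplace u (weakDeriv 2 u)) (hμ : 0 ≤ μ) {τ : ℝ} (hτ : 0 ≤ τ)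
    (hμτ : μ ^ 2 * τ < 1 / 4) {M : ℕ} {e ρ : ℕ → L2D}
    (h : ∀ m ∈ Finset.Icc 1 M, inner ℝ (e m - e (m - 1)) (T (e m) : L2D) + τ * ‖e m‖ ^ 2 -
      τ * μ ^ 2 * inner ℝ (e m) (T (e m) : L2D) = τ * inner ℝ (ρ m) (e m)) :
    ∑ m ∈ Finset.Icc 1 M, τ * ‖e m‖ ^ 2 ≤ Real.exp (4 * μ ^ 2 * (τ * M)) *
      (inner ℝ (e 0) (T (e 0) : L2D) + ∑ m ∈ Finset.Icc 1 M, τ * ‖ρ m‖ ^ 2) := by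
  refine sum_le_of_discrete_gronwall (E := fun m => inner ℝ (e m) (T (e m) : L2D))
    (a := fun m => ‖e m‖ ^ 2) (r := fun m => ‖ρ m‖ ^ 2) (sq_nonneg μ) hτ hμτ
    (fun m => hT.inner_nonneg hμ _) (fun m => sq_nonneg _) (fun m => sq_nonneg _) fun m hm => ?_
  have h1 := h m hm
  -- Positivity and symmetry of T give 2 (e - e', T e) ≥ (e, T e) - (e', T e'), where e' is the
  -- previous value. Young's inequality for (ρ, e) then uses up half of the dissipation ‖e‖².
  have h2 := hT.inner_nonneg hμ (e m - e (m - 1))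
  have h3 := hT.inner_comm hV (e m) (e (m - 1))
  rw [map_sub, Submodule.coe_sub, inner_sub_right, inner_sub_left, inner_sub_left, h3] at h2
  rw [inner_sub_left] at h1
  have h4 : τ * (2 * inner ℝ (ρ m) (e m)) ≤ τ * (‖ρ m‖ ^ 2 + ‖e m‖ ^ 2) := by
    refine mul_le_mul_of_nonneg_left ?_ hτ
    have := real_inner_le_norm (ρ m) (e m)
    nlinarith [sq_nonneg (‖ρ m‖ - ‖e m‖)]
  linarith

/-- Testing the scheme with T f and using the symmetry of the form, T undoes the discrete elliptic
operator up to the shift, leaving a plain L² product with f. -/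
lemma IsFullyDiscrete.inner_sub (hT : IsDiscreteSolution μ V T)
    (hV : ∀ u ∈ V, IsLaplace u (weakDeriv 2 u)) {τ : ℝ} {M : ℕ} {w₀ : L2D} {Wh : ℕ → L2D}
    (hW : IsFullyDiscrete μ τ M V w₀ Wh) {m : ℕ} (hm : m ∈ Finset.Icc 1 M) (f : L2D) :
    inner ℝ (Wh m - Wh (m - 1)) (T f : L2D) =
      -τ * inner ℝ f (Wh m) + τ * μ ^ 2 * inner ℝ (Wh m) (T f : L2D) := by
  obtain ⟨hmem, z, hz, hz'⟩ := hW.2 m hm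
  rw [eq_neg_of_add_eq_zero_left hz', inner_neg_left, real_inner_smul_left, hz.2 _ (T f).2]
  have h1 := hT f ⟨Wh m, hmem⟩
  rw [shiftedForm_comm (hV _ (T f).2) (hV _ hmem), shiftedForm] at h1
  rw [← h1]
  ring

/-- Stability of the fully-discrete method for data in the dual of `Ḣ²`. -/
lemma IsFullyDiscrete.stability [FiniteDimensional ℝ V]
    (hV : ∀ u ∈ V, IsLaplace u (weakDeriv 2 u)) (hμ : 0 ≤ μ) {τ : ℝ} (hτ : 0 ≤ τ)
    (hμτ : μ ^ 2 * τ < 1 / 4) {M : ℕ} {w₀ : L2D} {Wh : ℕ → L2D}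
    (hW : IsFullyDiscrete μ τ M V w₀ Wh) :
    ∑ m ∈ Finset.Icc 1 M, τ * ‖Wh m‖ ^ 2 ≤
      Real.exp (4 * μ ^ 2 * (τ * M)) * (2 * hdotNorm (-2) w₀ ^ 2) := by
  obtain ⟨T, hT⟩ := exists_isDiscreteSolution hV hμ
  have key := hT.energy_estimate hV hμ hτ hμτ (M := M) (e := Wh) (ρ := fun _ => 0) fun m hm => by
    rw [hW.inner_sub hT hV hm, inner_zero_left, real_inner_self_eq_norm_sq]
    ring
  -- T takes values in V and is symmetric, so it does not distinguish w₀ from its projection.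
  have h0 : inner ℝ (Wh 0) (T (Wh 0) : L2D) = inner ℝ w₀ (T w₀ : L2D) := by
    rw [hW.1.2 _ (T (Wh 0)).2, hT.inner_comm hV, hW.1.2 _ (T w₀).2]
  refine key.trans (mul_le_mul_of_nonneg_left ?_ (Real.exp_pos _).le)
  rw [h0]
  simpa using hT.inner_le hV hμ w₀

/-- `L²` error estimate for the elliptic projection, by duality. -/
lemma IsDiscreteSolution.elliptic_error (hT : IsDiscreteSolution μ V T)
    (hV : ∀ u ∈ V, IsLaplace u (weakDeriv 2 u)) (hμ : 0 ≤ μ) {s δ : ℝ} (hs : s ≤ 4) (hδ : 0 ≤ δ)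
    (happ : ∀ v a b, IsLaplace v a → IsLaplace a b →
      ∃ χ ∈ V, ‖a - weakDeriv 2 χ‖ ≤ δ * hdotNorm s v)
    {v a b : L2D} (hva : IsLaplace v a) (hab : IsLaplace a b) :
    ‖v - (T (b + μ • a + μ ^ 2 • v) : L2D)‖ ≤
      4 * (1 + μ + μ ^ 2) ^ 2 * δ ^ 2 * hdotNorm s v := by
  set R : V := T (b + μ • a + μ ^ 2 • v) with hR
  set c := 1 + μ + μ ^ 2 with hc
  have hc0 : 0 < c := by positivity
  set ρ := v - (R : L2D) with hρ
  set d := a - weakDeriv 2 (R : L2D) with hd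
  have hρd : IsLaplace ρ d := hva.sub (hV _ R.2)
  -- Galerkin orthogonality: R solves the discrete problem with the data of v.
  have horth : ∀ χ ∈ V, shiftedForm μ ρ d χ (weakDeriv 2 χ) = 0 := by
    intro χ hχ
    rw [hρ, hd, shiftedForm_sub_left, hab.shiftedForm_eq (hV χ hχ), sub_eq_zero]
    exact (hT _ ⟨χ, hχ⟩).symm
  have horth' : ∀ w k χ, IsLaplace w k → χ ∈ V → shiftedForm μ ρ d w k ≤
      c * (‖d‖ * ‖k - weakDeriv 2 χ‖) := by
    intro w k χ hw hχ
    have h1 := shiftedForm_le hμ hρd (hw.sub (hV χ hχ))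
    rwa [shiftedForm_sub_right, horth χ hχ, sub_zero] at h1
  -- Céa's argument: orthogonality replaces ρ by v - χ in the second slot, and coercivity with
  -- constant 1/2 accounts for the factor 2.
  have henergy : ‖d‖ ≤ 2 * c * (δ * hdotNorm s v) := by
    obtain ⟨χ, hχ, hb⟩ := happ v a b hva hab
    have h1 := horth' v a χ hva hχ
    have h2 : shiftedForm μ ρ d ρ d = shiftedForm μ ρ d v a := by
      have := horth R R.2
      have h3 := shiftedForm_sub_right μ ρ d v a R (weakDeriv 2 (R : L2D))
      rw [this, sub_zero] at h3
      exact h3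
    have h3 := shiftedForm_coercive hμ ρ d
    rw [h2] at h3
    have h4 : ‖d‖ * ‖d‖ ≤ ‖d‖ * (2 * c * ‖a - weakDeriv 2 χ‖) := by
      nlinarith [sq_nonneg (μ * ‖ρ‖)]
    rcases (norm_nonneg d).eq_or_lt with h0 | h0
    · rw [← h0]
      have := hdotNorm_nonneg s v
      positivity
    · exact (le_of_mul_le_mul_left h4 h0).trans (mul_le_mul_of_nonneg_left hb (by positivity))
  -- Dual problem with ρ as data. Approximating its solution contributes a second factor δ, and
  -- elliptic regularity bounds the solution by 2 ‖ρ‖.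
  obtain ⟨z, z₁, z₂, hz, hz', hzeq, hzn⟩ := exists_shifted_solution μ ρ
  obtain ⟨χ, hχ, hb⟩ := happ z z₁ z₂ hz hz'
  have h1 := horth' z z₁ χ hz hχ
  rw [shiftedForm_comm hρd hz, hz'.shiftedForm_eq hρd, hzeq, real_inner_self_eq_norm_sq] at h1
  have h2 : hdotNorm s z ≤ 2 * ‖ρ‖ := by
    refine le_trans ?_ hzn
    rw [← (hz.memHdot_four hz').2]
    exact (hz.memHdot_four hz').1.hdotNorm_mono hs
  have h3 : ‖z₁ - weakDeriv 2 χ‖ ≤ δ * (2 * ‖ρ‖) := hb.trans (mul_le_mul_of_nonneg_left h2 hδ)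
  have h4 : ‖d‖ * ‖z₁ - weakDeriv 2 χ‖ ≤ 2 * c * (δ * hdotNorm s v) * (δ * (2 * ‖ρ‖)) :=
    mul_le_mul henergy h3 (norm_nonneg _) ((norm_nonneg _).trans henergy)
  have h5 : ‖ρ‖ * ‖ρ‖ ≤ ‖ρ‖ * (4 * c ^ 2 * δ ^ 2 * hdotNorm s v) := by
    have := mul_le_mul_of_nonneg_left h4 hc0.le
    nlinarith
  rcases (norm_nonneg ρ).eq_or_lt with h0 | h0
  · rw [← h0]
    have := hdotNorm_nonneg s v
    positivity
  · exact le_of_mul_le_mul_left h5 h0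

end Galerkin

/-! ### The time-discrete method -/

lemma MemHdot.sineCoeff_ellipticOp {μ : ℝ} {v : L2D} (hv : MemHdot 4 v) (k : ℕ) :
    sineCoeff k (ellipticOp μ v) = (lam k ^ 4 - μ * lam k ^ 2) * sineCoeff k v := by
  obtain ⟨a, b, ha, hb⟩ := hv.exists_isLaplace
  rw [ha.ellipticOp_eq hb, sineCoeff_add, sineCoeff_smul, hb k, ha k]
  ring

lemma IsTimeDiscrete.sineCoeff_eq {μ τ : ℝ} {M : ℕ} {w₀ : L2D} {W : ℕ → L2D}
    (hW : IsTimeDiscrete μ τ M w₀ W) {m : ℕ} (hm : m ∈ Finset.Icc 1 M) (k : ℕ) :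
    sineCoeff k (W m) - sineCoeff k (W (m - 1)) +
      τ * ((lam k ^ 4 - μ * lam k ^ 2) * sineCoeff k (W m)) = 0 := by
  obtain ⟨h1, h2⟩ := hW.2 m hm
  have := congrArg (sineCoeff k) h2
  simpa [h1.sineCoeff_ellipticOp] using this

lemma isTimeDiscrete_of_sineCoeff {μ τ : ℝ} {M : ℕ} {w₀ : L2D} {W : ℕ → L2D} (h0 : W 0 = w₀)
    (h4 : ∀ m ∈ Finset.Icc 1 M, MemHdot 4 (W m))
    (h : ∀ m ∈ Finset.Icc 1 M, ∀ k, sineCoeff k (W m) - sineCoeff k (W (m - 1)) +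
      τ * ((lam k ^ 4 - μ * lam k ^ 2) * sineCoeff k (W m)) = 0) :
    IsTimeDiscrete μ τ M w₀ W := by
  refine ⟨h0, fun m hm => ⟨h4 m hm, ext_sineCoeff fun k => ?_⟩⟩
  simpa [(h4 m hm).sineCoeff_ellipticOp] using h m hm k

/-- Smoothing property of the time-discrete method for a single mode. -/
lemma IsTimeDiscrete.sum_sineCoeff_sq_le {μ τ : ℝ} (hτ : 0 ≤ τ) (hμτ : μ ^ 2 * τ < 1 / 4)
    {M : ℕ} {w₀ : L2D} {W : ℕ → L2D} (hW : IsTimeDiscrete μ τ M w₀ W) (k : ℕ) :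
    ∑ m ∈ Finset.Icc 1 M, τ * sineCoeff k (W m) ^ 2 ≤
      Real.exp (4 * μ ^ 2 * (τ * M)) * (2 / lam k ^ 4 * sineCoeff k w₀ ^ 2) := by
  set σ := lam k ^ 4 - μ * lam k ^ 2 + μ ^ 2 with hσ
  have hl : 0 < lam k ^ 4 := pow_pos (lam_pos k) 4
  have hσ2 : 1 / 2 * lam k ^ 4 ≤ σ := half_lam_pow_four_le μ k
  have hσ0 : 0 < σ := by linarith
  -- Dividing by σ, the symbol of the shifted operator, is the one-mode version of the energy (e, T
  -- e).
  have key := sum_le_of_discrete_gronwall (E := fun m => sineCoeff k (W m) ^ 2 / σ)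
    (a := fun m => sineCoeff k (W m) ^ 2) (r := fun _ => 0) (sq_nonneg μ) hτ hμτ
    (fun m => div_nonneg (sq_nonneg _) hσ0.le) (fun m => sq_nonneg _) (fun _ => le_rfl)
    (M := M) fun m hm => by
      have h1 := hW.sineCoeff_eq hm k
      set y := sineCoeff k (W m)
      set z := sineCoeff k (W (m - 1))
      have h2 : y - z + τ * ((σ - μ ^ 2) * y) = 0 := by rw [← h1, hσ]; ring
      have h3 : (1 - 2 * (μ ^ 2 * τ)) * y ^ 2 + τ * y ^ 2 * σ ≤ z ^ 2 := by
        have h4 : 0 ≤ τ * y ^ 2 * σ := by positivity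
        have h5 : (y - z + τ * ((σ - μ ^ 2) * y)) * y = 0 := by rw [h2, zero_mul]
        nlinarith [sq_nonneg (y - z)]
      have e : (1 - 2 * (μ ^ 2 * τ)) * (y ^ 2 / σ) + τ * y ^ 2 =
          ((1 - 2 * (μ ^ 2 * τ)) * y ^ 2 + τ * y ^ 2 * σ) / σ := by
        field_simp
      simp only [mul_zero, add_zero]
      rw [e]
      exact div_le_div_of_nonneg_right h3 hσ0.le
  refine key.trans (mul_le_mul_of_nonneg_left ?_ (Real.exp_pos _).le)
  simp only [mul_zero, Finset.sum_const_zero, add_zero, hW.1]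
  rw [div_le_iff₀ hσ0]
  have : 1 ≤ 2 / lam k ^ 4 * σ := by
    rw [div_mul_eq_mul_div, le_div_iff₀ hl]
    linarith
  nlinarith [sq_nonneg (sineCoeff k w₀)]

/-- Smoothing property of the time-discrete method. -/
lemma IsTimeDiscrete.sum_hdotNorm_sq_le {μ τ : ℝ} (hτ : 0 ≤ τ) (hμτ : μ ^ 2 * τ < 1 / 4)
    {M : ℕ} {w₀ : L2D} {W : ℕ → L2D} (hW : IsTimeDiscrete μ τ M w₀ W) {s : ℝ} (hs : s ≤ 4)
    (hw : MemHdot (s - 2) w₀) :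
    ∑ m ∈ Finset.Icc 1 M, τ * hdotNorm s (W m) ^ 2 ≤
      Real.exp (4 * μ ^ 2 * (τ * M)) * (2 * hdotNorm (s - 2) w₀ ^ 2) := by
  have h1 := hasSum_sum (s := Finset.Icc 1 M) fun m hm =>
    (((hW.2 m hm).1.mono hs).hasSum.mul_left τ)
  have h2 := (hw.hasSum.mul_left 2).mul_left (Real.exp (4 * μ ^ 2 * (τ * M)))
  refine hasSum_le (fun k => ?_) h1 h2
  have hp : 0 ≤ lam k ^ (2 * s) := Real.rpow_nonneg (lam_pos k).le _
  have h3 := mul_le_mul_of_nonneg_left (hW.sum_sineCoeff_sq_le hτ hμτ k) hp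
  have e : lam k ^ (2 * (s - 2)) = lam k ^ (2 * s) / lam k ^ 4 := by
    rw [← Real.rpow_natCast, ← Real.rpow_sub (lam_pos k)]
    congr 1
    push_cast
    ring
  rw [e]
  refine le_trans (le_of_eq ?_) (h3.trans (le_of_eq ?_))
  · rw [Finset.mul_sum]
    exact Finset.sum_congr rfl fun m _ => by ring
  · ring

/-! ### Spectral truncation -/

open Classical in
lemma exists_truncation (S : Set ℕ) (v : L2D) :
    ∃ u : L2D, ∀ k, sineCoeff k u = if k ∈ S then sineCoeff k v else 0 :=
  exists_sineCoeff_eq (Summable.of_nonneg_of_le (fun k => sq_nonneg _)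
    (fun k => by split_ifs <;> simp [sq_nonneg]) (hasSum_sineCoeff_sq v).summable)

open Classical in
/-- Restriction of the sine expansion of `v` to the modes in `S`. -/
noncomputable def truncate (S : Set ℕ) (v : L2D) : L2D := (exists_truncation S v).choose

lemma sineCoeff_truncate_of_mem {S : Set ℕ} {k : ℕ} (hk : k ∈ S) (v : L2D) :
    sineCoeff k (truncate S v) = sineCoeff k v := by
  rw [truncate, (exists_truncation S v).choose_spec, if_pos hk]

lemma sineCoeff_truncate_of_notMem {S : Set ℕ} {k : ℕ} (hk : k ∉ S) (v : L2D) :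
    sineCoeff k (truncate S v) = 0 := by
  rw [truncate, (exists_truncation S v).choose_spec, if_neg hk]

lemma sineCoeff_truncate_sq_le (S : Set ℕ) (k : ℕ) (v : L2D) :
    sineCoeff k (truncate S v) ^ 2 ≤ sineCoeff k v ^ 2 := by
  by_cases hk : k ∈ S
  · rw [sineCoeff_truncate_of_mem hk]
  · rw [sineCoeff_truncate_of_notMem hk]
    simp [sq_nonneg]

lemma truncate_compl (S : Set ℕ) (v : L2D) : truncate Sᶜ v = v - truncate S v := by
  refine ext_sineCoeff fun k => ?_
  by_cases hk : k ∈ S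
  · rw [sineCoeff_truncate_of_notMem (by simpa using hk), sineCoeff_sub,
      sineCoeff_truncate_of_mem hk, sub_self]
  · rw [sineCoeff_truncate_of_mem (by simpa using hk), sineCoeff_sub,
      sineCoeff_truncate_of_notMem hk, sub_zero]

lemma MemHdot.truncate {s : ℝ} {v : L2D} (hv : MemHdot s v) (S : Set ℕ) :
    MemHdot s (truncate S v) :=
  Summable.of_nonneg_of_le (hdot_term_nonneg s _) (fun k => mul_le_mul_of_nonneg_left
    (sineCoeff_truncate_sq_le S k v) (Real.rpow_nonneg (lam_pos k).le _)) hv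

/-- The time-discrete scheme is diagonal in the sine basis, so it commutes with discarding modes. -/
lemma IsTimeDiscrete.truncate {μ τ : ℝ} {M : ℕ} {w₀ : L2D} {W : ℕ → L2D}
    (hW : IsTimeDiscrete μ τ M w₀ W) (S : Set ℕ) :
    IsTimeDiscrete μ τ M (truncate S w₀) fun m => truncate S (W m) := by
  refine isTimeDiscrete_of_sineCoeff (by simp only [hW.1])
    (fun m hm => (hW.2 m hm).1.truncate S) fun m hm k => ?_
  by_cases hk : k ∈ S
  · simp only [sineCoeff_truncate_of_mem hk]
    exact hW.sineCoeff_eq hm k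
  · simp only [sineCoeff_truncate_of_notMem hk]
    ring

/-- Comparison of truncated norms, mode by mode. -/
lemma hdotNorm_truncate_sq_le {s t A : ℝ} {S : Set ℕ} {v : L2D} (hs : MemHdot s v)
    (ht : MemHdot t v) (h : ∀ k ∈ S, lam k ^ (2 * s) ≤ A * lam k ^ (2 * t)) (hA : 0 ≤ A) :
    hdotNorm s (truncate S v) ^ 2 ≤ A * hdotNorm t v ^ 2 := by
  refine hasSum_le (fun k => ?_) (hs.truncate S).hasSum (ht.hasSum.mul_left A)
  by_cases hk : k ∈ S
  · rw [sineCoeff_truncate_of_mem hk, ← mul_assoc]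
    exact mul_le_mul_of_nonneg_right (h k hk) (sq_nonneg _)
  · rw [sineCoeff_truncate_of_notMem hk]
    have := mul_nonneg hA (hdot_term_nonneg t v k)
    simpa using this

/-! ### Error estimates -/

section Error

variable {V : Submodule ℝ L2D} {μ τ : ℝ} {M : ℕ} {w₀ : L2D} {W Wh : ℕ → L2D}

/-- The squared discrete `L²`-in-time norm of the error. -/
noncomputable def errorSq (τ : ℝ) (M : ℕ) (W Wh : ℕ → L2D) : ℝ :=
  ∑ m ∈ Finset.Icc 1 M, τ * ‖W m - Wh m‖ ^ 2

lemma sum_norm_sub_sq_le (hτ : 0 ≤ τ) (u v : ℕ → L2D) :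
    ∑ m ∈ Finset.Icc 1 M, τ * ‖u m - v m‖ ^ 2 ≤
      2 * ∑ m ∈ Finset.Icc 1 M, τ * ‖u m‖ ^ 2 + 2 * ∑ m ∈ Finset.Icc 1 M, τ * ‖v m‖ ^ 2 := by
  rw [Finset.mul_sum, Finset.mul_sum, ← Finset.sum_add_distrib]
  refine Finset.sum_le_sum fun m _ => ?_
  have h1 := norm_sub_le (u m) (v m)
  have h2 : ‖u m - v m‖ ^ 2 ≤ 2 * ‖u m‖ ^ 2 + 2 * ‖v m‖ ^ 2 := by
    nlinarith [sq_nonneg (‖u m‖ - ‖v m‖), norm_nonneg (u m - v m), norm_nonneg (u m),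
      norm_nonneg (v m)]
  nlinarith [mul_le_mul_of_nonneg_left h2 hτ]

/-- Error bound without any rate, for data in the dual of `Ḣ²`. -/
lemma errorSq_le_stability [FiniteDimensional ℝ V]
    (hV : ∀ u ∈ V, IsLaplace u (weakDeriv 2 u)) (hμ : 0 ≤ μ) (hτ : 0 ≤ τ)
    (hμτ : μ ^ 2 * τ < 1 / 4) (hW : IsTimeDiscrete μ τ M w₀ W)
    (hWh : IsFullyDiscrete μ τ M V w₀ Wh) :
    errorSq τ M W Wh ≤ Real.exp (4 * μ ^ 2 * (τ * M)) * (8 * hdotNorm (-2) w₀ ^ 2) := by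
  have h1 := hWh.stability hV hμ hτ hμτ
  have h2 := hW.sum_hdotNorm_sq_le hτ hμτ (s := 0) (by norm_num)
    ((memHdot_zero w₀).1.mono (by norm_num))
  simp only [(memHdot_zero _).2, zero_sub] at h2
  have h3 := sum_norm_sub_sq_le (M := M) hτ W Wh
  rw [errorSq]
  linarith

/-- Error bound of optimal order. -/
lemma errorSq_le_rate [FiniteDimensional ℝ V]
    (hV : ∀ u ∈ V, IsLaplace u (weakDeriv 2 u)) (hμ : 0 ≤ μ) (hτ : 0 ≤ τ)
    (hμτ : μ ^ 2 * τ < 1 / 4) (hW : IsTimeDiscrete μ τ M w₀ W)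
    (hWh : IsFullyDiscrete μ τ M V w₀ Wh) {s δ : ℝ} (hs : s ≤ 4) (hδ : 0 ≤ δ)
    (hw : MemHdot (s - 2) w₀)
    (happ : ∀ v a b, IsLaplace v a → IsLaplace a b →
      ∃ χ ∈ V, ‖a - weakDeriv 2 χ‖ ≤ δ * hdotNorm s v) :
    errorSq τ M W Wh ≤ Real.exp (4 * μ ^ 2 * (τ * M)) ^ 2 *
      (32 * (1 + μ + μ ^ 2) ^ 4 * δ ^ 4 * hdotNorm (s - 2) w₀ ^ 2) := by
  obtain ⟨T, hT⟩ := exists_isDiscreteSolution hV hμ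
  set C := Real.exp (4 * μ ^ 2 * (τ * M)) with hC
  set c := 4 * (1 + μ + μ ^ 2) ^ 2 * δ ^ 2 with hc
  -- The error equation, tested with T e, has as residual the error ρ of the elliptic projection of
  -- W m. Outside the range of time steps the value of ρ is immaterial.
  have hex : ∀ m, ∃ ρ : L2D, m ∈ Finset.Icc 1 M →
      ‖ρ‖ ≤ c * hdotNorm s (W m) ∧
      inner ℝ ((W m - Wh m) - (W (m - 1) - Wh (m - 1))) (T (W m - Wh m) : L2D) +
        τ * ‖W m - Wh m‖ ^ 2 - τ * μ ^ 2 * inner ℝ (W m - Wh m) (T (W m - Wh m) : L2D) =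
        τ * inner ℝ ρ (W m - Wh m) := by
    intro m
    by_cases hm : m ∈ Finset.Icc 1 M
    · obtain ⟨h4, heq⟩ := hW.2 m hm
      obtain ⟨a, b, ha, hb⟩ := h4.exists_isLaplace
      refine ⟨W m - (T (b + μ • a + μ ^ 2 • W m) : L2D), fun _ =>
        ⟨hT.elliptic_error hV hμ hs hδ happ ha hb, ?_⟩⟩
      rw [ha.ellipticOp_eq hb] at heq
      have h1 := hWh.inner_sub hT hV hm (W m - Wh m)
      set e := W m - Wh m with he
      have h2 : inner ℝ (W m - W (m - 1)) (T e : L2D) =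
          -τ * inner ℝ (b + μ • a + μ ^ 2 • W m) (T e : L2D) +
            τ * μ ^ 2 * inner ℝ (W m) (T e : L2D) := by
        rw [eq_neg_of_add_eq_zero_left heq, inner_neg_left, real_inner_smul_left,
          inner_add_left (b + μ • a), real_inner_smul_left]
        ring
      rw [hT.inner_comm hV (b + μ • a + μ ^ 2 • W m)] at h2
      have h3 : e - (W (m - 1) - Wh (m - 1)) = (W m - W (m - 1)) - (Wh m - Wh (m - 1)) := by
        rw [he]; abel
      have h4 : inner ℝ e e = inner ℝ e (W m) - inner ℝ e (Wh m) := by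
        rw [← inner_sub_right]
      have h5 : inner ℝ e (T e : L2D) = inner ℝ (W m) (T e : L2D) - inner ℝ (Wh m) (T e : L2D) := by
        rw [← inner_sub_left]
      have h6 : inner ℝ (W m - (T (b + μ • a + μ ^ 2 • W m) : L2D)) e =
          inner ℝ e (W m) - inner ℝ e (T (b + μ • a + μ ^ 2 • W m) : L2D) := by
        rw [real_inner_comm, inner_sub_right]
      rw [h3, inner_sub_left, h1, h2, ← real_inner_self_eq_norm_sq, h6]
      rw [h4, h5]
      ring
    · exact ⟨0, fun h => absurd h hm⟩
  choose ρ hρ using hex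
  have key := hT.energy_estimate hV hμ hτ hμτ (M := M) (e := fun m => W m - Wh m) (ρ := ρ)
    fun m hm => (hρ m hm).2
  -- The initial error is orthogonal to V, in which T takes its values.
  have h0 : inner ℝ (W 0 - Wh 0) (T (W 0 - Wh 0) : L2D) = 0 := by
    rw [inner_sub_left, hWh.1.2 _ (T (W 0 - Wh 0)).2, hW.1, sub_self]
  rw [h0, zero_add] at key
  have h1 : ∑ m ∈ Finset.Icc 1 M, τ * ‖ρ m‖ ^ 2 ≤
      c ^ 2 * ∑ m ∈ Finset.Icc 1 M, τ * hdotNorm s (W m) ^ 2 := by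
    rw [Finset.mul_sum]
    refine Finset.sum_le_sum fun m hm => ?_
    have := pow_le_pow_left₀ (norm_nonneg _) (hρ m hm).1 2
    have h2 := mul_le_mul_of_nonneg_left this hτ
    refine h2.trans (le_of_eq (by ring))
  have h2 := hW.sum_hdotNorm_sq_le hτ hμτ hs hw
  have hC0 : 0 ≤ C := (Real.exp_pos _).le
  calc errorSq τ M W Wh ≤ C * ∑ m ∈ Finset.Icc 1 M, τ * ‖ρ m‖ ^ 2 := key
    _ ≤ C * (c ^ 2 * (C * (2 * hdotNorm (s - 2) w₀ ^ 2))) :=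
        mul_le_mul_of_nonneg_left
          (h1.trans (mul_le_mul_of_nonneg_left h2 (sq_nonneg c))) hC0
    _ = _ := by rw [hc]; ring

end Error

/-! ### Interpolation by splitting the modes -/

lemma IsTimeDiscrete.sub_truncate {μ τ : ℝ} {M : ℕ} {w₀ : L2D} {W : ℕ → L2D}
    (hW : IsTimeDiscrete μ τ M w₀ W) (S : Set ℕ) :
    IsTimeDiscrete μ τ M (w₀ - CHFE.truncate S w₀) fun m => W m - CHFE.truncate S (W m) := by
  simpa only [truncate_compl] using hW.truncate Sᶜ

lemma errorSq_le_add {τ : ℝ} (hτ : 0 ≤ τ) (M : ℕ) (W Wh U Uh : ℕ → L2D) :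
    errorSq τ M W Wh ≤
      2 * errorSq τ M U Uh + 2 * errorSq τ M (fun m => W m - U m) fun m => Wh m - Uh m := by
  have h := sum_norm_sub_sq_le (M := M) hτ (fun m => U m - Uh m)
    fun m => -((W m - U m) - (Wh m - Uh m))
  simp only [norm_neg] at h
  refine le_trans (le_of_eq (Finset.sum_congr rfl fun m _ => ?_)) h
  congr 3
  abel

/-- The excess of the exponent 2(p-2) over 2(pθ-2) is 2p(1-θ) ≥ 0, so the surplus power of λ^p is at
most the same power of L. -/
lemma lam_rpow_le_of_low {p L θ : ℝ} {k : ℕ} (hθ : θ ≤ 1) (hk : lam k ^ p ≤ L) :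
    lam k ^ (2 * (p - 2)) ≤ L ^ (2 * (1 - θ)) * lam k ^ (2 * (p * θ - 2)) := by
  have hl := lam_pos k
  have e : lam k ^ (2 * (p - 2)) = (lam k ^ p) ^ (2 * (1 - θ)) * lam k ^ (2 * (p * θ - 2)) := by
    rw [← Real.rpow_mul hl.le, ← Real.rpow_add hl]
    congr 1
    ring
  rw [e]
  exact mul_le_mul_of_nonneg_right
    (Real.rpow_le_rpow (Real.rpow_nonneg hl.le _) hk (by linarith)) (Real.rpow_nonneg hl.le _)

/-- Here the exponent falls short by 2pθ, and λ^p ≥ L turns the missing power into a gain L^(-2θ).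
-/
lemma lam_rpow_le_of_high {p L θ : ℝ} {k : ℕ} (hL : 0 < L) (hθ : 0 ≤ θ) (hk : L ≤ lam k ^ p) :
    lam k ^ (2 * (-2 : ℝ)) ≤ L ^ (-(2 * θ)) * lam k ^ (2 * (p * θ - 2)) := by
  have hl := lam_pos k
  have e : lam k ^ (2 * (-2 : ℝ)) = (lam k ^ p) ^ (-(2 * θ)) * lam k ^ (2 * (p * θ - 2)) := by
    rw [← Real.rpow_mul hl.le, ← Real.rpow_add hl]
    congr 1
    ring
  rw [e]
  exact mul_le_mul_of_nonneg_right
    (Real.rpow_le_rpow_of_nonpos hL hk (by linarith)) (Real.rpow_nonneg hl.le _)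

/-- Interpolation between the stability bound and the optimal order bound: low and high modes of
the initial data are treated separately. -/
lemma errorSq_le_interpolation {V : Submodule ℝ L2D} [FiniteDimensional ℝ V]
    (hV : ∀ u ∈ V, IsLaplace u (weakDeriv 2 u)) {μ τ : ℝ} (hμ : 0 ≤ μ) (hτ : 0 < τ)
    (hμτ : μ ^ 2 * τ < 1 / 4) {M : ℕ} {w₀ : L2D} (hw : MemHdot 2 w₀) {W Wh : ℕ → L2D}
    (hW : IsTimeDiscrete μ τ M w₀ W) (hWh : IsFullyDiscrete μ τ M V w₀ Wh)
    {p A L θ : ℝ} (hp0 : 0 ≤ p) (hp : p ≤ 4) (hA : 0 ≤ A) (hL : 0 < L) (hθ0 : 0 ≤ θ) (hθ1 : θ ≤ 1)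
    {δ : ℝ} (hδ : 0 ≤ δ) (hδL : δ ^ 4 = A * L ^ (-(2 : ℝ)))
    (happ : ∀ v a b, IsLaplace v a → IsLaplace a b →
      ∃ χ ∈ V, ‖a - weakDeriv 2 χ‖ ≤ δ * hdotNorm p v) :
    errorSq τ M W Wh ≤
      (2 * (Real.exp (4 * μ ^ 2 * (τ * M)) ^ 2 * (32 * (1 + μ + μ ^ 2) ^ 4 * A)) +
        2 * (Real.exp (4 * μ ^ 2 * (τ * M)) * 8)) *
        (L ^ (-(2 * θ)) * hdotNorm (p * θ - 2) w₀ ^ 2) := by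
  set C := Real.exp (4 * μ ^ 2 * (τ * M)) with hC
  have hC0 : 0 < C := Real.exp_pos _
  -- With this cut both parts produce the same factor: L⁻² · L^(2(1-θ)) = L^(-2θ) for low modes, and
  -- L^(-2θ) directly for high ones.
  set S : Set ℕ := {k | lam k ^ p ≤ L} with hS
  -- The fully-discrete method is not diagonal, so its solution for the truncated data has to be
  -- constructed; the remainder `Wh - Uh` then solves it for the high modes by linearity.
  obtain ⟨Uh, hUh⟩ := exists_isFullyDiscrete hV hτ hμτ M (truncate S w₀)
  have hξ : MemHdot (p * θ - 2) w₀ := hw.mono (by nlinarith)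
  have h1 := errorSq_le_rate hV hμ hτ.le hμτ (hW.truncate S) hUh hp hδ
    ((hw.mono (by linarith)).truncate S) happ
  have h2 := errorSq_le_stability hV hμ hτ.le hμτ (hW.sub_truncate S) (hWh.sub hV hUh)
  rw [← truncate_compl] at h2
  have h3 := hdotNorm_truncate_sq_le (S := S) (hw.mono (by linarith)) hξ
    (fun k hk => lam_rpow_le_of_low hθ1 hk) (Real.rpow_nonneg hL.le _)
  have h4 := hdotNorm_truncate_sq_le (S := Sᶜ) (hw.mono (by norm_num)) hξ
    (fun k hk => lam_rpow_le_of_high hL hθ0 (le_of_lt (not_le.mp hk))) (Real.rpow_nonneg hL.le _)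
  have h5 := errorSq_le_add hτ.le M W Wh (fun m => truncate S (W m)) Uh
  have e : L ^ (-(2 : ℝ)) * L ^ (2 * (1 - θ)) = L ^ (-(2 * θ)) := by
    rw [← Real.rpow_add hL]
    congr 1
    ring
  rw [hδL] at h1
  set X := hdotNorm (p * θ - 2) w₀ ^ 2
  have hL2 : 0 ≤ L ^ (-(2 : ℝ)) := Real.rpow_nonneg hL.le _
  have h6 : C ^ 2 * (32 * (1 + μ + μ ^ 2) ^ 4 * (A * L ^ (-(2 : ℝ))) *
      hdotNorm (p - 2) (truncate S w₀) ^ 2) ≤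
      C ^ 2 * (32 * (1 + μ + μ ^ 2) ^ 4 * A) * (L ^ (-(2 * θ)) * X) := by
    calc _ ≤ C ^ 2 * (32 * (1 + μ + μ ^ 2) ^ 4 * (A * L ^ (-(2 : ℝ))) *
          (L ^ (2 * (1 - θ)) * X)) := by gcongr
      _ = C ^ 2 * (32 * (1 + μ + μ ^ 2) ^ 4 * A) *
          ((L ^ (-(2 : ℝ)) * L ^ (2 * (1 - θ))) * X) := by ring
      _ = _ := by rw [e]
  have h7 : C * (8 * hdotNorm (-2) (truncate Sᶜ w₀) ^ 2) ≤ C * 8 * (L ^ (-(2 * θ)) * X) := by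
    rw [mul_assoc]
    gcongr
  linarith

end CHFE

/-! ### Choice of the constants -/

theorem theorem5p1 (r : ℕ) (hr : r = 2 ∨ r = 3) (T : ℝ) (hT : 0 < T) (μ : ℝ) (hμ : 0 ≤ μ)
    (K : ℝ) :
    ∃ c : ℝ, 0 ≤ c ∧
      ∀ (N : ℕ) (x : Fin (N + 1) → ℝ) (h : ℝ), CHFE.IsPartition N x h →
      ∀ V : Submodule ℝ CHFE.L2D, CHFE.IsFiniteElementSpace K r x h V →
      ∀ (M : ℕ) (τ : ℝ), 0 < M → τ = T / M → μ ^ 2 * τ < 1 / 4 →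
      ∀ w₀ : CHFE.L2D, CHFE.MemHdot 2 w₀ →
      ∀ W Wh : ℕ → CHFE.L2D,
        CHFE.IsTimeDiscrete μ τ M w₀ W → CHFE.IsFullyDiscrete μ τ M V w₀ Wh →
      ∀ θ : ℝ, 0 ≤ θ → θ ≤ 1 →
        Real.sqrt (∑ m ∈ Finset.Icc 1 M, τ * ‖W m - Wh m‖ ^ 2) ≤
          c * h ^ (CHFE.ellStar r * θ) * CHFE.hdotNorm (CHFE.xiStar r θ) w₀ := by
  -- The approximation constant enters to the fourth power: duality squares it and the error itself
  -- is squared.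
  set A : ℝ := (3 * |K| + 1) ^ 4 with hA
  set C : ℝ := Real.exp (4 * μ ^ 2 * T) with hC
  set B : ℝ := 2 * (C ^ 2 * (32 * (1 + μ + μ ^ 2) ^ 4 * A)) + 2 * (C * 8) with hB
  have hB0 : 0 ≤ B := by positivity
  refine ⟨Real.sqrt B, Real.sqrt_nonneg _, ?_⟩
  intro N x h hx V hV M τ hM hτ hμτ w₀ hw W Wh hW hWh θ hθ0 hθ1
  have hM' : (0 : ℝ) < M := by exact_mod_cast hM
  have hτ0 : 0 < τ := hτ ▸ div_pos hT hM'
  -- This removes the step size from the Gronwall constant and leaves only T and μ.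
  have hτM : τ * M = T := by rw [hτ, div_mul_cancel₀ _ hM'.ne']
  have hh := hx.pos
  have := hx.finiteDimensional r
  have : FiniteDimensional ℝ V := Submodule.finiteDimensional_of_le hV.le
  have hVl : ∀ u ∈ V, CHFE.IsLaplace u (CHFE.weakDeriv 2 u) := fun u hu =>
    CHFE.isLaplace_of_mem_splineSpace (hV.le hu)
  have hr4 : (r : ℝ) + 1 ≤ 4 := by rcases hr with rfl | rfl <;> norm_num
  have hell : CHFE.ellStar r = 2 * ((r - 1 : ℕ) : ℝ) := by
    rcases hr with rfl | rfl <;> norm_num [CHFE.ellStar]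
  have hL : 0 < h ^ (-CHFE.ellStar r) := Real.rpow_pos_of_pos hh _
  -- Since ℓ⋆ = 2(r-1), the choice L = h^(-ℓ⋆) makes δ⁴ = A h^(4(r-1)) equal to A L⁻², as the
  -- interpolation requires.
  have key := CHFE.errorSq_le_interpolation hVl hμ hτ0 hμτ hw hW hWh (p := (r : ℝ) + 1) (A := A)
    (L := h ^ (-CHFE.ellStar r)) (by positivity) hr4 (by positivity) hL hθ0 hθ1
    (δ := (3 * |K| + 1) * h ^ (r - 1)) (by positivity) (by
      rw [mul_pow, ← Real.rpow_mul hh.le, hell, ← pow_mul, ← Real.rpow_natCast h]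
      congr 2
      push_cast
      ring)
    fun v a b hva hab => hV.exists_approx hx hr hva hab
  rw [hτM, ← hC, ← hB] at key
  have e : (h ^ (-CHFE.ellStar r)) ^ (-(2 * θ)) = (h ^ (CHFE.ellStar r * θ)) ^ 2 := by
    rw [← Real.rpow_mul hh.le, ← Real.rpow_natCast, ← Real.rpow_mul hh.le]
    congr 1
    push_cast
    ring
  rw [e] at key
  refine Real.sqrt_le_iff.mpr ⟨mul_nonneg (mul_nonneg (Real.sqrt_nonneg _)
    (Real.rpow_nonneg hh.le _)) (CHFE.hdotNorm_nonneg _ _), ?_⟩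
  rw [mul_pow, mul_pow, Real.sq_sqrt hB0, mul_assoc]
  exact key
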